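/- Let $p\ge 1$, let $S$ be a symmetric positive semidefinite $p\times p$ matrix, and let $\lambda>0$, $\alpha\in(0,1]$, $\epsilon>0$. Write $\lambda_1=\alpha\lambda$, $\lambda_2=(1-\alpha)\lambda/2$, $\|A\|_1=\sum_{i,j}|A_{ij}|$, $\|A\|_F$ for the Frobenius norm, $\|A\|_2$ for the spectral norm, and let $\mathcal M$ be the set of symmetric $p\times p$ matrices and $\mathcal M_+$ the set of its positive definite elements. For $0<\ell$ and $\psi\in[0,\infty]$ let $\mathcal M_+(\ell,\psi)=\{\theta\in\mathcal M_+:\lambda_{\min}(\theta)\ge\ell,\ \lambda_{\max}(\theta)\le\psi\}$. Let $g_\alpha(\theta)=\sum_{i,j}\big(\alpha\lambda|\theta_{ij}|+\tfrac{1-\alpha}{2}\lambda\theta_{ij}^2\big)$, let $\operatorname{Prox}_\gamma(x)=\operatorname{argmin}_{u\in\mathcal M}\{g_\alpha(u)+\tfrac1{2\gamma}\|u-x\|_F^2\}$, and let $\hat\theta$ denote the minimizer over $\mathcal M_+$ of $-\log\det\theta+\operatorname{Tr}(\theta S)+g_\alpha(\theta)$. For $e\ge0$ put $\mu_e=\|S\|_2+(\lambda_1+e)p$,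 $\nu_e=\lambda_{\min}(S)-(\lambda_1+e)p$, and $$\ell_\star(e)=\begin{cases}\dfrac{-\mu_e+\sqrt{\mu_e^2+8\lambda_2}}{4\lambda_2}&\alpha<1,\\[2mm] 1/\mu_e&\alpha=1,\end{cases}\qquad \psi^1_\star(e)=\begin{cases}\dfrac{-\nu_e+\sqrt{\nu_e^2+8\lambda_2}}{4\lambda_2}&\alpha<1,\\[2mm] 1/\nu_e&\alpha=1,\ \nu_e>0,\\ +\infty&\alpha=1,\ \nu_e\le0.\end{cases}$$ Let $\ell_\star=\ell_\star(0)$, $\theta(t)=(S+t\lambda_1I)^{-1}$, and $\psi_{UB}=\min\{U_1,U_2\}$ with $$U_1=\frac1{\lambda_1}\big(p-\ell_\star\operatorname{Tr}(S)-2p\lambda_2\ell_\star^2\big),\qquad U_2=\inf_{0<t<1}\frac{\lambda_1\|\theta(t)\|_1-t\lambda_1\operatorname{Tr}(\theta(t))+\lambda_2\|\theta(t)\|_F^2-\lambda_2\ell_\star^2p}{\lambda_1(1-t)}.$$ Fix a step size $\gamma\in(0,\ell_\star(\epsilon)^2]$, positive integers $N_1,N_2,\dots$, and a starting point $\theta_0\in\mathcal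 M_+\big(\ell_\star(\epsilon),\min(\psi_{UB},\psi^1_\star(\epsilon))\big)$. Let $\{\theta_k\}_{k\ge0}$ be the stochastic process in which, for each $k\ge1$ and as long as $\theta_{k-1}\in\mathcal M_+$, given $\sigma(\theta_0,\dots,\theta_{k-1})$ one draws $z_1,\dots,z_{N_k}$ i.i.d. from $\mathbf N(0,\theta_{k-1}^{-1})$ and sets $$\Sigma_k=\frac1{N_k}\sum_{j=1}^{N_k}z_jz_j',\qquad \theta_k=\operatorname{Prox}_\gamma\big(\theta_{k-1}-\gamma(S-\Sigma_k)\big).$$ For $\psi\in[0,\infty]$ let $\tau(\ell,\psi)=\inf\{k\ge0:\theta_k\notin\mathcal M_+(\ell,\psi)\}$, with $\inf\emptyset=\infty$; for a random variable $\Psi$, $\tau(\ell,\Psi)$ equals $\tau(\ell,\psi)$ on $\{\Psi=\psi\}$. Then there exists a random variable $\Psi_\star(\epsilon)$ with values in $[\ell_\star(\epsilon),\infty]$ such that $$\mathbb P\big[\tau(\ell_\star(\epsilon),\Psi_\star(\epsilon))=\infty\big]\ \ge\ 1-4p^2\sum_{k\ge1}\exp\Big(-\min\Big(1,\frac{\epsilon^2\ell_\star(\epsilon)^2}{16}\Big)N_k\Big),$$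 and such that, if $\sum_{k\ge1}N_k^{-1}<\infty$, then $\mathbb E\big(\Psi_\star(\epsilon)^2\big)<\infty$ (hence $\Psi_\star(\epsilon)<\infty$ almost surely), and almost surely on $\{\tau(\ell_\star(\epsilon),\Psi_\star(\epsilon))=\infty\}$, $\lim_{k\to\infty}\theta_k=\hat\theta$. -/

import Mathlib

open MeasureTheory ProbabilityTheory Filter Topology
open scoped ENNReal Matrix

noncomputable section

namespace ElasticNetPrecision

variable {p : ℕ}

/-- The Frobenius norm `√ Tr(Aᵀ A)`. -/
def frobNorm (A : Matrix (Fin p) (Fin p) ℝ) : ℝ := Real.sqrt (Aᵀ * A).trace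

/-- The entrywise norm `∑ i, j, |A i j|`. -/
def entryNorm (A : Matrix (Fin p) (Fin p) ℝ) : ℝ := ∑ i, ∑ j, |A i j|

/-- The spectral norm. -/
def specNorm (A : Matrix (Fin p) (Fin p) ℝ) : ℝ := ‖Matrix.toEuclideanCLM (𝕜 := ℝ) A‖

/-- Smallest eigenvalue (of a symmetric matrix of positive size). -/
def eigMin (A : Matrix (Fin p) (Fin p) ℝ) : ℝ := sInf (spectrum ℝ A)

/-- Largest eigenvalue (of a symmetric matrix of positive size). -/
def eigMax (A : Matrix (Fin p) (Fin p) ℝ) : ℝ := sSup (spectrum ℝ A)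

/-- The positive definite matrices with all eigenvalues in `[ℓ, ψ]`, where `ψ = ∞` is allowed. -/
def spectralBox (p : ℕ) (ℓ : ℝ) (ψ : ℝ≥0∞) : Set (Matrix (Fin p) (Fin p) ℝ) :=
  {θ | θ.PosDef ∧ ℓ ≤ eigMin θ ∧ ENNReal.ofReal (eigMax θ) ≤ ψ}

/-- The elastic net penalty. -/
def penalty (α lam : ℝ) (θ : Matrix (Fin p) (Fin p) ℝ) : ℝ :=
  ∑ i, ∑ j, (α * lam * |θ i j| + (1 - α) / 2 * lam * θ i j ^ 2)

/-- The penalized negative log-likelihood (used on positive definite matrices only). -/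
def objective (S : Matrix (Fin p) (Fin p) ℝ) (α lam : ℝ) (θ : Matrix (Fin p) (Fin p) ℝ) : ℝ :=
  -Real.log θ.det + (θ * S).trace + penalty α lam θ

/-- `θ` minimizes the penalized negative log-likelihood over the positive definite matrices. -/
def IsSolution (S : Matrix (Fin p) (Fin p) ℝ) (α lam : ℝ) (θ : Matrix (Fin p) (Fin p) ℝ) : Prop :=
  θ.PosDef ∧ IsMinOn (objective S α lam) {u | u.PosDef} θ

/-- `v` is the value at `x` of the proximal map of `γ` times the penalty, i.e. the minimizer of
`u ↦ penalty u + ‖u - x‖² / (2γ)` over all symmetric matrices. -/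
def IsProx (γ α lam : ℝ) (x v : Matrix (Fin p) (Fin p) ℝ) : Prop :=
  v.IsSymm ∧ IsMinOn (fun u => penalty α lam u + 1 / (2 * γ) * frobNorm (u - x) ^ 2)
    {u | u.IsSymm} v

/-- `λ₁ = α λ`. -/
def lam₁ (α lam : ℝ) : ℝ := α * lam

/-- `λ₂ = (1 - α) λ / 2`. -/
def lam₂ (α lam : ℝ) : ℝ := (1 - α) * lam / 2

/-- `μ_ε = ‖S‖₂ + (λ₁ + ε) p`. -/
def mu (S : Matrix (Fin p) (Fin p) ℝ) (α lam ε : ℝ) : ℝ := specNorm S + (lam₁ α lam + ε) * p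

/-- `ν_ε = λ_min(S) - (λ₁ + ε) p`. -/
def nu (S : Matrix (Fin p) (Fin p) ℝ) (α lam ε : ℝ) : ℝ := eigMin S - (lam₁ α lam + ε) * p

/-- `ℓ_⋆(ε)`; the quantity `ℓ_⋆` is `ℓ_⋆(0)`. -/
def ellStar (S : Matrix (Fin p) (Fin p) ℝ) (α lam ε : ℝ) : ℝ :=
  if α < 1 then
    (-mu S α lam ε + Real.sqrt (mu S α lam ε ^ 2 + 8 * lam₂ α lam)) / (4 * lam₂ α lam)
  else 1 / mu S α lam ε

/-- `ψ_⋆¹(ε)`, possibly infinite. -/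
def psiOne (S : Matrix (Fin p) (Fin p) ℝ) (α lam ε : ℝ) : ℝ≥0∞ :=
  if α < 1 then
    ENNReal.ofReal
      ((-nu S α lam ε + Real.sqrt (nu S α lam ε ^ 2 + 8 * lam₂ α lam)) / (4 * lam₂ α lam))
  else if 0 < nu S α lam ε then ENNReal.ofReal (1 / nu S α lam ε)
  else ⊤

/-- `U₁`. -/
def boundU₁ (S : Matrix (Fin p) (Fin p) ℝ) (α lam : ℝ) : ℝ :=
  1 / lam₁ α lam *
    (p - ellStar S α lam 0 * S.trace - 2 * p * lam₂ α lam * ellStar S α lam 0 ^ 2)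

/-- `θ(t) = (S + t λ₁ I)⁻¹`. -/
def ridgeInv (S : Matrix (Fin p) (Fin p) ℝ) (α lam t : ℝ) : Matrix (Fin p) (Fin p) ℝ :=
  (S + (t * lam₁ α lam) • (1 : Matrix (Fin p) (Fin p) ℝ))⁻¹

/-- `c(t)`. -/
def boundC (S : Matrix (Fin p) (Fin p) ℝ) (α lam t : ℝ) : ℝ :=
  1 / (lam₁ α lam * (1 - t)) *
      (lam₁ α lam * entryNorm (ridgeInv S α lam t)
        - t * lam₁ α lam * (ridgeInv S α lam t).trace
        + lam₂ α lam * frobNorm (ridgeInv S α lam t) ^ 2)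
    - lam₂ α lam * ellStar S α lam 0 ^ 2 * p / (lam₁ α lam * (1 - t))

/-- `U₂ = inf_{0 < t < 1} c(t)`. -/
def boundU₂ (S : Matrix (Fin p) (Fin p) ℝ) (α lam : ℝ) : ℝ :=
  sInf (boundC S α lam '' Set.Ioo 0 1)

/-- `ψ_UB = min(U₁, U₂)`. -/
def psiUB (S : Matrix (Fin p) (Fin p) ℝ) (α lam : ℝ) : ℝ :=
  min (boundU₁ S α lam) (boundU₂ S α lam)

/-- The first time at which the sequence `θ` is outside the box; it is `⊤` if there is none. -/
def exitTime (θ : ℕ → Matrix (Fin p) (Fin p) ℝ) (ℓ : ℝ) (ψ : ℝ≥0∞) : ℕ∞ :=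
  ⨅ k ∈ {k : ℕ | θ k ∉ spectralBox p ℓ ψ}, (k : ℕ∞)

/-- The empirical second moment matrix `N⁻¹ ∑ j, z_j z_jᵀ`. -/
def empCov {n : ℕ} (z : Fin n → EuclideanSpace ℝ (Fin p)) : Matrix (Fin p) (Fin p) ℝ :=
  (n : ℝ)⁻¹ • ∑ j, Matrix.vecMulVec (z j) (z j)

/-- The sigma-algebra generated by `θ 0, …, θ k`. -/
abbrev history {Ω : Type*} (θ : ℕ → Ω → Matrix (Fin p) (Fin p) ℝ) (k : ℕ) : MeasurableSpace Ω :=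
  ⨆ j ∈ Set.Iic k, ⨆ a, ⨆ b, MeasurableSpace.comap (fun ω => θ j ω a b) inferInstance

/-- `θ` is the stochastic proximal gradient process started at `θ₀`, with step size `γ` and batch
sizes `N 1, N 2, …`; `z k` is the batch drawn at iteration `k` (`z 0` plays no role).
A step is performed when the current state is positive definite; nothing is required of the steps
after a state that is not. -/
structure IsStochasticProx {Ω : Type*} [MeasurableSpace Ω] (P : Measure Ω)
    (S : Matrix (Fin p) (Fin p) ℝ) (α lam γ : ℝ) (N : ℕ → ℕ) (θ₀ : Matrix (Fin p) (Fin p) ℝ)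
    (θ : ℕ → Ω → Matrix (Fin p) (Fin p) ℝ)
    (z : (k : ℕ) → Ω → Fin (N k) → EuclideanSpace ℝ (Fin p)) : Prop where
  measurable_state : ∀ k a b, Measurable fun ω => θ k ω a b
  measurable_batch : ∀ k, Measurable (z k)
  init : ∀ ω, θ 0 ω = θ₀
  /-- Given `θ 0, …, θ k`, the vectors in the batch `z (k + 1)` are i.i.d. with
  law `N(0, (θ k)⁻¹)`. -/
  batch_law : ∀ k, ∀ A : Set Ω, MeasurableSet[history θ k] A → (∀ ω ∈ A, (θ k ω).PosDef) →
    ∀ B : Set (Fin (N (k + 1)) → EuclideanSpace ℝ (Fin p)), MeasurableSet B →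
      P (A ∩ z (k + 1) ⁻¹' B) =
        ∫⁻ ω in A, (Measure.pi fun _ : Fin (N (k + 1)) => multivariateGaussian 0 (θ k ω)⁻¹) B ∂P
  step : ∀ k ω, (θ k ω).PosDef →
    IsProx γ α lam (θ k ω - γ • (S - empCov (z (k + 1) ω))) (θ (k + 1) ω)

end ElasticNetPrecision

end

open ElasticNetPrecision

namespace ElasticNetPrecision

variable {p : ℕ}

/-! The minimizer `u` is a fixed point of the exact proximal gradient map, and the algorithm
iterates this map with gradient error `empCov - θ⁻¹`. Everything rests on two properties of one
step.

Lower spectral bound (`posSemidef_step`). `ℓ⋆(ε)` solves `2 λ₂ x² + μ_ε x = 1`, which is the balance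
of forces at the smallest eigenvalue in the worst case. If all entries of the error are at most `ε`,
a step therefore maps `{θ ≥ ℓ⋆(ε)}` into itself. Chi-square concentration given the past, a union
bound over the `p²` entries and a sum over the steps give the stated probability.

Distance to the minimizer (`frobNorm_step_sub_le`). The proximal map is nonexpansive, and `θ ↦ θ + γ
θ⁻¹` contracts towards `u` by the factor `1 - γ / (2 ‖θ‖ ‖u‖)`. The gain degenerates as `‖θ‖` grows,
but far from `u` it still brings the iterate closer by a fixed amount `c` per step. An error smaller
than `c` is absorbed, and a larger one costs at most a multiple of its square. Hence the squared
distance, truncated from below, grows at most by a factor `1 + K ‖error‖²` (`exists_step_growth`).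

The conditional mean of `‖error‖²` is `O(1 / N)`, so when `∑ 1 / N` converges a Grönwall argument
bounds the initial value plus the sum of all increments in expectation
(`IsStochasticProx.exists_norm_bound`). That sum, up to a constant, is a single random bound `V` for
all `‖θ k‖²` before the lower bound fails, and `Ψ` is essentially `√V`. Its finiteness also forces
the error to vanish. On paths that never leave the box the iterates are then bounded with vanishing
error, the contraction is uniform, and they converge (`tendsto_of_noise_tendsto_zero`). -/

/-! ### Frobenius geometry of matrices -/

/-- The Frobenius inner product of real matrices. -/
def frobInner (A B : Matrix (Fin p) (Fin p) ℝ) : ℝ := ∑ i, ∑ j, A i j * B i j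

lemma frobInner_eq_trace (A B : Matrix (Fin p) (Fin p) ℝ) :
    frobInner A B = (Aᵀ * B).trace := by
  simp only [frobInner, Matrix.trace, Matrix.diag_apply, Matrix.mul_apply, Matrix.transpose_apply]
  exact Finset.sum_comm

/-- A square matrix seen as a Euclidean vector. -/
def toVec : Matrix (Fin p) (Fin p) ℝ →ₗ[ℝ] EuclideanSpace ℝ (Fin p × Fin p) where
  toFun A := WithLp.toLp 2 fun q => A q.1 q.2
  map_add' A B := by ext q; simp
  map_smul' c A := by ext q; simp

lemma inner_toVec (A B : Matrix (Fin p) (Fin p) ℝ) :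
    inner ℝ (toVec A) (toVec B) = frobInner A B := by
  simp only [toVec, LinearMap.coe_mk, AddHom.coe_mk, PiLp.inner_apply, frobInner,
    Fintype.sum_prod_type]
  simp [mul_comm]

lemma norm_toVec (A : Matrix (Fin p) (Fin p) ℝ) : ‖toVec A‖ = frobNorm A := by
  rw [frobNorm, ← frobInner_eq_trace, ← inner_toVec, real_inner_self_eq_norm_sq,
    Real.sqrt_sq (norm_nonneg _)]

lemma frobNorm_sq (A : Matrix (Fin p) (Fin p) ℝ) : frobNorm A ^ 2 = frobInner A A := by
  rw [← norm_toVec, ← inner_toVec, real_inner_self_eq_norm_sq]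

lemma frobNorm_nonneg (A : Matrix (Fin p) (Fin p) ℝ) : 0 ≤ frobNorm A := Real.sqrt_nonneg _

lemma frobNorm_sq_eq_sum (A : Matrix (Fin p) (Fin p) ℝ) :
    frobNorm A ^ 2 = ∑ i, ∑ j, A i j ^ 2 := by
  rw [frobNorm_sq]; simp [frobInner, sq]

lemma frobNorm_add_le (A B : Matrix (Fin p) (Fin p) ℝ) :
    frobNorm (A + B) ≤ frobNorm A + frobNorm B := by
  simp only [← norm_toVec, map_add]; exact norm_add_le _ _

lemma frobNorm_smul (c : ℝ) (A : Matrix (Fin p) (Fin p) ℝ) :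
    frobNorm (c • A) = |c| * frobNorm A := by
  simp only [← norm_toVec, map_smul, norm_smul, Real.norm_eq_abs]

lemma frobInner_le_frobNorm_mul (A B : Matrix (Fin p) (Fin p) ℝ) :
    frobInner A B ≤ frobNorm A * frobNorm B := by
  rw [← inner_toVec, ← norm_toVec, ← norm_toVec]; exact real_inner_le_norm _ _

lemma frobInner_sub_left (A B C : Matrix (Fin p) (Fin p) ℝ) :
    frobInner (A - B) C = frobInner A C - frobInner B C := by
  simp only [← inner_toVec, map_sub, inner_sub_left]

lemma frobInner_sub_right (A B C : Matrix (Fin p) (Fin p) ℝ) :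
    frobInner A (B - C) = frobInner A B - frobInner A C := by
  simp only [← inner_toVec, map_sub, inner_sub_right]

lemma frobInner_smul_left (c : ℝ) (A B : Matrix (Fin p) (Fin p) ℝ) :
    frobInner (c • A) B = c * frobInner A B := by
  simp only [← inner_toVec, map_smul, real_inner_smul_left]

lemma frobInner_smul_right (c : ℝ) (A B : Matrix (Fin p) (Fin p) ℝ) :
    frobInner A (c • B) = c * frobInner A B := by
  simp only [← inner_toVec, map_smul, real_inner_smul_right]

lemma frobNorm_sub_sq (A B : Matrix (Fin p) (Fin p) ℝ) :
    frobNorm (A - B) ^ 2 = frobNorm A ^ 2 - 2 * frobInner A B + frobNorm B ^ 2 := by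
  simp only [← norm_toVec, ← inner_toVec, map_sub]; exact norm_sub_sq_real _ _

lemma eq_zero_of_frobNorm_eq_zero {A : Matrix (Fin p) (Fin p) ℝ} (h : frobNorm A = 0) :
    A = 0 := by
  rw [← norm_toVec, norm_eq_zero] at h
  ext i j
  simpa [toVec] using congrArg (fun v : EuclideanSpace ℝ (Fin p × Fin p) => v (i, j)) h

lemma abs_entry_le_frobNorm (A : Matrix (Fin p) (Fin p) ℝ) (i j : Fin p) :
    |A i j| ≤ frobNorm A := by
  rw [← norm_toVec]; exact PiLp.norm_apply_le (toVec A) (i, j)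

lemma frobInner_vecMulVec (A : Matrix (Fin p) (Fin p) ℝ) (w : Fin p → ℝ) :
    frobInner A (Matrix.vecMulVec w w) = w ⬝ᵥ A *ᵥ w := by
  simp only [frobInner, Matrix.vecMulVec_apply, dotProduct, Matrix.mulVec, Finset.mul_sum]
  refine Finset.sum_congr rfl fun i _ => Finset.sum_congr rfl fun j _ => by ring

/-- Cauchy–Schwarz for `(∑ |w i|)²`. This is the origin of the factor `p` in `mu`, both for the `ℓ¹`
penalty and for entrywise errors. -/
lemma entryNorm_vecMulVec_le (w : Fin p → ℝ) :
    entryNorm (Matrix.vecMulVec w w) ≤ p * (w ⬝ᵥ w) := by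
  have h1 : entryNorm (Matrix.vecMulVec w w) = (∑ i, |w i|) ^ 2 := by
    simp only [entryNorm, Matrix.vecMulVec_apply, abs_mul, sq, Finset.sum_mul_sum]
  have h2 := sq_sum_le_card_mul_sum_sq (s := Finset.univ) (f := fun i => |w i|)
  rw [h1]
  simpa [dotProduct, sq] using h2

lemma abs_frobInner_le {A B : Matrix (Fin p) (Fin p) ℝ} {e : ℝ} (h : ∀ i j, |A i j| ≤ e) :
    |frobInner A B| ≤ e * entryNorm B := by
  simp only [frobInner, entryNorm, Finset.mul_sum]
  refine (Finset.abs_sum_le_sum_abs _ _).trans (Finset.sum_le_sum fun i _ => ?_)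
  refine (Finset.abs_sum_le_sum_abs _ _).trans (Finset.sum_le_sum fun j _ => ?_)
  rw [abs_mul]; exact mul_le_mul_of_nonneg_right (h i j) (abs_nonneg _)

/-! ### The positive semidefinite order and inverses -/

lemma posSemidef_iff_isSymm {A : Matrix (Fin p) (Fin p) ℝ} :
    A.PosSemidef ↔ A.IsSymm ∧ ∀ w, 0 ≤ w ⬝ᵥ A *ᵥ w := by
  rw [Matrix.posSemidef_iff_dotProduct_mulVec]
  simp [Matrix.IsHermitian, Matrix.IsSymm, Matrix.conjTranspose_eq_transpose_of_trivial]

lemma isSymm_of_posDef {A : Matrix (Fin p) (Fin p) ℝ} (h : A.PosDef) : A.IsSymm :=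
  (posSemidef_iff_isSymm.1 h.posSemidef).1

lemma posSemidef_sub_smul_one_iff {A : Matrix (Fin p) (Fin p) ℝ} (hA : A.IsSymm) (c : ℝ) :
    (A - c • (1 : Matrix (Fin p) (Fin p) ℝ)).PosSemidef ↔ ∀ w, c * (w ⬝ᵥ w) ≤ w ⬝ᵥ A *ᵥ w := by
  have hs : (A - c • (1 : Matrix (Fin p) (Fin p) ℝ)).IsSymm :=
    hA.sub (Matrix.isSymm_one.smul c)
  simp [posSemidef_iff_isSymm, hs, Matrix.sub_mulVec, Matrix.smul_mulVec, dotProduct_sub]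

lemma posDef_of_posSemidef_sub {A : Matrix (Fin p) (Fin p) ℝ} {c : ℝ} (hc : 0 < c)
    (h : (A - c • (1 : Matrix (Fin p) (Fin p) ℝ)).PosSemidef) : A.PosDef := by
  have := (Matrix.PosDef.one (n := Fin p) (R := ℝ)).smul hc
  simpa using Matrix.PosDef.posSemidef_add h this

/-- Factor `Q = Bᴴ B` and cycle the trace: it becomes the trace of `B P Bᴴ`. -/
lemma trace_mul_nonneg_of_posSemidef {P Q : Matrix (Fin p) (Fin p) ℝ} (hP : P.PosSemidef)
    (hQ : Q.PosSemidef) : 0 ≤ (P * Q).trace := by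
  obtain ⟨B, rfl⟩ : ∃ B : Matrix (Fin p) (Fin p) ℝ, Q = Bᴴ * B := by
    open scoped MatrixOrder in
    obtain ⟨B, hB⟩ := CStarAlgebra.nonneg_iff_eq_star_mul_self.1 hQ.nonneg
    exact ⟨B, hB⟩
  rw [← mul_assoc, Matrix.trace_mul_comm, ← mul_assoc]
  exact (hP.mul_mul_conjTranspose_same B).trace_nonneg

/-- The bound `θ⁻¹ ≥ 2 s - s² θ`. -/
lemma quadForm_inv_ge {A : Matrix (Fin p) (Fin p) ℝ} (hA : A.PosDef) (s : ℝ) (w : Fin p → ℝ) :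
    2 * s * (w ⬝ᵥ w) - s ^ 2 * (w ⬝ᵥ A *ᵥ w) ≤ w ⬝ᵥ A⁻¹ *ᵥ w := by
  -- Positivity of `A` at `A⁻¹ w - s w`, expanded, is the claim.
  have h := (posSemidef_iff_isSymm.1 hA.posSemidef).2 (A⁻¹ *ᵥ w - s • w)
  have hdet : IsUnit A.det := (Matrix.isUnit_iff_isUnit_det A).1 hA.isUnit
  have hAi : (A⁻¹)ᵀ = A⁻¹ := by rw [Matrix.transpose_nonsing_inv, isSymm_of_posDef hA]
  have e1 : A *ᵥ (A⁻¹ *ᵥ w) = w := by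
    rw [Matrix.mulVec_mulVec, Matrix.mul_nonsing_inv _ hdet, Matrix.one_mulVec]
  have e2 : (A⁻¹ *ᵥ w) ⬝ᵥ (A *ᵥ w) = w ⬝ᵥ w := by
    rw [Matrix.dotProduct_mulVec, ← Matrix.mulVec_transpose, isSymm_of_posDef hA, e1]
  rw [Matrix.mulVec_sub, e1, Matrix.mulVec_smul, sub_dotProduct, dotProduct_sub, dotProduct_sub,
    dotProduct_smul, smul_dotProduct, smul_dotProduct, dotProduct_smul, e2,
    dotProduct_comm (A⁻¹ *ᵥ w) w] at h
  simp only [smul_eq_mul] at h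
  linarith

lemma quadForm_le_frobNorm (A : Matrix (Fin p) (Fin p) ℝ) (w : Fin p → ℝ) :
    w ⬝ᵥ A *ᵥ w ≤ frobNorm A * (w ⬝ᵥ w) := by
  rw [← frobInner_vecMulVec]
  refine (frobInner_le_frobNorm_mul _ _).trans_eq ?_
  have : frobNorm (Matrix.vecMulVec w w) ^ 2 = (w ⬝ᵥ w) ^ 2 := by
    rw [frobNorm_sq_eq_sum]
    simp only [Matrix.vecMulVec_apply, dotProduct, sq, Finset.sum_mul_sum]
    refine Finset.sum_congr rfl fun i _ => Finset.sum_congr rfl fun j _ => by ring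
  rw [(pow_left_inj₀ (frobNorm_nonneg _) (by
    simpa [dotProduct] using Finset.sum_nonneg fun i _ => mul_self_nonneg (w i)) two_ne_zero).1 this]

lemma dotProduct_self_nonneg' (w : Fin p → ℝ) : 0 ≤ w ⬝ᵥ w := by
  simpa [dotProduct] using Finset.sum_nonneg fun i _ => mul_self_nonneg (w i)

/-- `θ⁻¹ ≥ ‖θ‖⁻¹`. -/
lemma posSemidef_inv_sub {A : Matrix (Fin p) (Fin p) ℝ} (hA : A.PosDef) {h : ℝ} (hh : 0 < h)
    (hAh : frobNorm A ≤ h) : (A⁻¹ - h⁻¹ • (1 : Matrix (Fin p) (Fin p) ℝ)).PosSemidef := by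
  rw [posSemidef_sub_smul_one_iff (isSymm_of_posDef hA.inv)]
  intro w
  have h1 := quadForm_inv_ge hA h⁻¹ w
  have h2 := (quadForm_le_frobNorm A w).trans
    (mul_le_mul_of_nonneg_right hAh (dotProduct_self_nonneg' w))
  have h3 : h⁻¹ ^ 2 * (w ⬝ᵥ A *ᵥ w) ≤ h⁻¹ ^ 2 * (h * (w ⬝ᵥ w)) := by gcongr
  have h4 : h⁻¹ ^ 2 * (h * (w ⬝ᵥ w)) = h⁻¹ * (w ⬝ᵥ w) := by field_simp
  linarith

/-- `θ⁻¹ - ℓ θ⁻² ≥ 0` when `θ ≥ ℓ`. -/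
lemma posSemidef_inv_sub_smul_sq {A : Matrix (Fin p) (Fin p) ℝ} (hA : A.PosDef) {l : ℝ}
    (h : (A - l • (1 : Matrix (Fin p) (Fin p) ℝ)).PosSemidef) :
    (A⁻¹ - l • (A⁻¹ * A⁻¹)).PosSemidef := by
  have hdet : IsUnit A.det := (Matrix.isUnit_iff_isUnit_det A).1 hA.isUnit
  -- Conjugating `θ - l ≥ 0` by `θ⁻¹`.
  have := h.mul_mul_conjTranspose_same A⁻¹
  rwa [hA.inv.isHermitian, mul_sub, sub_mul, Matrix.nonsing_inv_mul _ hdet, one_mul, mul_smul_comm,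
    mul_one, smul_mul_assoc] at this

/-- The linearization of `θ ↦ θ + γ θ⁻¹` contracts. -/
lemma frobNorm_sub_smul_mul_mul_sq_le {T U X : Matrix (Fin p) (Fin p) ℝ} {l γ a b : ℝ}
    (hT : T.PosDef) (hU : U.PosDef) (hγ : 0 ≤ γ) (hγl : γ ≤ l ^ 2) (hl : 0 ≤ l)
    (hTl : (T - l • (1 : Matrix (Fin p) (Fin p) ℝ)).PosSemidef)
    (hUl : (U - l • (1 : Matrix (Fin p) (Fin p) ℝ)).PosSemidef)
    (ha : 0 < a) (hb : 0 < b) (hTa : frobNorm T ≤ a) (hUb : frobNorm U ≤ b) :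
    frobNorm (X - γ • (T⁻¹ * X * U⁻¹)) ^ 2 ≤ (1 - γ / (a * b)) * frobNorm X ^ 2 := by
  set A := T⁻¹ with hAdef
  set B := U⁻¹ with hBdef
  have hA : A.PosDef := hT.inv
  have hB : B.PosDef := hU.inv
  have hAt : Aᵀ = A := isSymm_of_posDef hA
  have hBt : Bᵀ = B := isSymm_of_posDef hB
  have conj {P : Matrix (Fin p) (Fin p) ℝ} (hP : P.PosSemidef) : (Xᵀ * P * X).PosSemidef := by
    have := hP.conjTranspose_mul_mul_same X
    rwa [Matrix.conjTranspose_eq_transpose_of_trivial] at this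
  have hBB : (B * B).PosSemidef := by
    have := Matrix.posSemidef_conjTranspose_mul_self B
    rwa [Matrix.conjTranspose_eq_transpose_of_trivial, hBt] at this
  set t := frobInner X (A * X * B) with ht
  have ht' : t = (Xᵀ * A * X * B).trace := by
    rw [ht, frobInner_eq_trace]; simp only [mul_assoc]
  -- With `t = ⟨X, A X B⟩`, removing one factor at a time: `i1` and `i2` give `l² ‖A X B‖² ≤ t`,
  -- while `i3` and `i4` give `‖X‖² / (a b) ≤ t`.
  have i1 := trace_mul_nonneg_of_posSemidef (conj (posSemidef_inv_sub_smul_sq hT hTl)) hBB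
  have i2 := trace_mul_nonneg_of_posSemidef (conj hA.posSemidef)
    (posSemidef_inv_sub_smul_sq hU hUl)
  have i3 := trace_mul_nonneg_of_posSemidef (conj (posSemidef_inv_sub hT ha hTa)) hB.posSemidef
  have i4 := trace_mul_nonneg_of_posSemidef (conj Matrix.PosSemidef.one)
    (posSemidef_inv_sub hU hb hUb)
  rw [← hAdef] at i1 i3
  rw [← hBdef] at i2 i4
  simp only [mul_sub, sub_mul, Matrix.trace_sub, mul_smul_comm, smul_mul_assoc, Matrix.trace_smul,
    smul_eq_mul, mul_one] at i1 i2 i3 i4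
  have hn : frobNorm (A * X * B) ^ 2 = (Xᵀ * (A * A) * X * (B * B)).trace := by
    rw [frobNorm_sq, frobInner_eq_trace, Matrix.transpose_mul, Matrix.transpose_mul, hAt, hBt,
      mul_assoc, Matrix.trace_mul_comm]
    simp only [mul_assoc]
  have hX : frobNorm X ^ 2 = (Xᵀ * X).trace := by rw [frobNorm_sq, frobInner_eq_trace]
  have j1 : l ^ 2 * frobNorm (A * X * B) ^ 2 ≤ t := by
    rw [hn, ht']
    nlinarith [mul_le_mul_of_nonneg_left (sub_nonneg.1 i1) hl]
  have j2 : a⁻¹ * (b⁻¹ * frobNorm X ^ 2) ≤ t := by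
    rw [hX, ht']
    have := mul_le_mul_of_nonneg_left (sub_nonneg.1 i4) (inv_pos.2 ha).le
    linarith
  -- The step size restriction makes the quadratic term absorb only half of the cross term: `-2 γ t
  -- + γ² ‖A X B‖² ≤ -γ t`.
  have j3 : γ * frobNorm (A * X * B) ^ 2 ≤ t :=
    (mul_le_mul_of_nonneg_right hγl (sq_nonneg _)).trans j1
  rw [frobNorm_sub_sq, frobInner_smul_right, frobNorm_smul, mul_pow, sq_abs, ← ht]
  have j4 := mul_le_mul_of_nonneg_left j3 hγ
  have j5 := mul_le_mul_of_nonneg_left j2 hγ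
  have j6 : γ / (a * b) * frobNorm X ^ 2 = γ * (a⁻¹ * (b⁻¹ * frobNorm X ^ 2)) := by
    field_simp
  rw [sub_mul, one_mul, j6]
  nlinarith

/-- The resolvent identity. The linearization is exact, with the two endpoints in place of an
intermediate point, so norm bounds on `T` and `U` themselves suffice. -/
lemma add_smul_inv_sub {T U : Matrix (Fin p) (Fin p) ℝ} (hT : T.PosDef) (hU : U.PosDef) (γ : ℝ) :
    (T + γ • T⁻¹) - (U + γ • U⁻¹) = (T - U) - γ • (T⁻¹ * (T - U) * U⁻¹) := by
  have hdT : IsUnit T.det := (Matrix.isUnit_iff_isUnit_det T).1 hT.isUnit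
  have hdU : IsUnit U.det := (Matrix.isUnit_iff_isUnit_det U).1 hU.isUnit
  rw [mul_sub, sub_mul, Matrix.nonsing_inv_mul _ hdT, one_mul, mul_assoc,
    Matrix.mul_nonsing_inv _ hdU, mul_one]
  module

/-! ### First-order conditions from one-sided limits -/

lemma nonneg_of_forall_nonneg_quadratic {a b : ℝ}
    (h : ∀ t : ℝ, 0 < t → t ≤ 1 → 0 ≤ t * a + t ^ 2 * b) : 0 ≤ a := by
  have h1 : ∀ᶠ t : ℝ in 𝓝[>] 0, 0 ≤ a + t * b := by
    filter_upwards [Ioc_mem_nhdsGT (zero_lt_one' ℝ)] with t ht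
    have := h t ht.1 ht.2
    have h2 : t * a + t ^ 2 * b = t * (a + t * b) := by ring
    rw [h2] at this
    exact nonneg_of_mul_nonneg_right this ht.1
  have h2 : Tendsto (fun t : ℝ => a + t * b) (𝓝[>] 0) (𝓝 (a + 0 * b)) :=
    (Continuous.tendsto (by fun_prop) 0).mono_left nhdsWithin_le_nhds
  simpa using ge_of_tendsto h2 h1

lemma HasDerivAt.nonneg_of_eventually_le {f : ℝ → ℝ} {d : ℝ} (hf : HasDerivAt f d 0)
    (h : ∀ᶠ t in 𝓝[>] 0, f 0 ≤ f t) : 0 ≤ d := by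
  refine ge_of_tendsto hf.tendsto_slope_zero_right ?_
  filter_upwards [h, self_mem_nhdsWithin] with t ht ht0
  have : (0 : ℝ) < t := ht0
  simp only [zero_add, smul_eq_mul]
  exact mul_nonneg (inv_nonneg.2 this.le) (sub_nonneg.2 ht)

/-! ### The penalty -/

lemma penalty_eq (α lam : ℝ) (A : Matrix (Fin p) (Fin p) ℝ) :
    penalty α lam A = lam₁ α lam * entryNorm A + lam₂ α lam * frobNorm A ^ 2 := by
  simp only [penalty, lam₁, lam₂, entryNorm, frobNorm_sq_eq_sum, Finset.mul_sum,
    ← Finset.sum_add_distrib]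
  refine Finset.sum_congr rfl fun i _ => Finset.sum_congr rfl fun j _ => by ring

lemma entryNorm_add_le (A B : Matrix (Fin p) (Fin p) ℝ) :
    entryNorm (A + B) ≤ entryNorm A + entryNorm B := by
  simp only [entryNorm, ← Finset.sum_add_distrib]
  exact Finset.sum_le_sum fun i _ => Finset.sum_le_sum fun j _ => abs_add_le _ _

lemma entryNorm_smul (c : ℝ) (A : Matrix (Fin p) (Fin p) ℝ) :
    entryNorm (c • A) = |c| * entryNorm A := by
  simp [entryNorm, Finset.mul_sum, abs_mul]

lemma frobNorm_add_smul_sq (A H : Matrix (Fin p) (Fin p) ℝ) (t : ℝ) :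
    frobNorm (A + t • H) ^ 2 = frobNorm A ^ 2 + 2 * t * frobInner A H + t ^ 2 * frobNorm H ^ 2 := by
  have := frobNorm_sub_sq A ((-t) • H)
  rw [neg_smul, sub_neg_eq_add, ← neg_smul, frobInner_smul_right, frobNorm_smul, mul_pow, sq_abs]
    at this
  rw [this]; ring

lemma penalty_add_smul_le {α lam : ℝ} (hα : 0 < α) (hlam : 0 < lam)
    (v H : Matrix (Fin p) (Fin p) ℝ) {t : ℝ} (ht : 0 ≤ t) :
    penalty α lam (v + t • H) ≤ penalty α lam v + t * (lam₁ α lam * entryNorm H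
      + 2 * lam₂ α lam * frobInner v H) + t ^ 2 * (lam₂ α lam * frobNorm H ^ 2) := by
  have h1 : entryNorm (v + t • H) ≤ entryNorm v + t * entryNorm H := by
    refine (entryNorm_add_le _ _).trans_eq ?_
    rw [entryNorm_smul, abs_of_nonneg ht]
  have h2 : 0 < lam₁ α lam := mul_pos hα hlam
  rw [penalty_eq, penalty_eq, frobNorm_add_smul_sq]
  nlinarith

lemma penalty_convex_comb {α lam : ℝ} (hα : 0 < α) (hα' : α ≤ 1) (hlam : 0 < lam)
    (v u : Matrix (Fin p) (Fin p) ℝ) {t : ℝ} (ht : 0 ≤ t) (ht1 : t ≤ 1) :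
    penalty α lam (v + t • (u - v)) ≤
      penalty α lam v + t * (penalty α lam u - penalty α lam v) := by
  have h1 : entryNorm (v + t • (u - v)) ≤ (1 - t) * entryNorm v + t * entryNorm u := by
    rw [show v + t • (u - v) = (1 - t) • v + t • u by module]
    refine (entryNorm_add_le _ _).trans_eq ?_
    rw [entryNorm_smul, entryNorm_smul, abs_of_nonneg ht, abs_of_nonneg (sub_nonneg.2 ht1)]
  have h2 : 0 < lam₁ α lam := mul_pos hα hlam
  have h3 : 0 ≤ lam₂ α lam := by
    have : 0 ≤ 1 - α := by linarith
    unfold lam₂; positivity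
  have h4 : frobNorm u ^ 2 = frobNorm v ^ 2 + 2 * 1 * frobInner v (u - v)
      + 1 ^ 2 * frobNorm (u - v) ^ 2 := by
    rw [← frobNorm_add_smul_sq]; congr 2; module
  have h5 : frobNorm (v + t • (u - v)) ^ 2 ≤ frobNorm v ^ 2
      + t * (frobNorm u ^ 2 - frobNorm v ^ 2) := by
    rw [frobNorm_add_smul_sq, h4]
    nlinarith [mul_nonneg (mul_nonneg ht (sub_nonneg.2 ht1)) (sq_nonneg (frobNorm (u - v)))]
  rw [penalty_eq, penalty_eq, penalty_eq]
  nlinarith [mul_le_mul_of_nonneg_left h1 h2.le, mul_le_mul_of_nonneg_left h5 h3]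

/-! ### The variational inequality of the proximal map -/

/-- The variational inequality characterizing the value `v` at `x` of the proximal map. -/
def ProxVI (γ α lam : ℝ) (x v : Matrix (Fin p) (Fin p) ℝ) : Prop :=
  v.IsSymm ∧ ∀ u : Matrix (Fin p) (Fin p) ℝ, u.IsSymm →
    frobInner (x - v) (u - v) ≤ γ * (penalty α lam u - penalty α lam v)

/-- Compare `v` with `v + t (u - v)`, bound the penalty by its chord, and keep the term linear in
`t`. No subgradient of the penalty is needed. -/
lemma IsProx.proxVI {γ α lam : ℝ} (hγ : 0 < γ) (hα : 0 < α) (hα' : α ≤ 1) (hlam : 0 < lam)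
    {x v : Matrix (Fin p) (Fin p) ℝ} (h : IsProx γ α lam x v) : ProxVI γ α lam x v := by
  refine ⟨h.1, fun u hu => ?_⟩
  have key : 0 ≤ γ * (penalty α lam u - penalty α lam v) - frobInner (x - v) (u - v) := by
    refine nonneg_of_forall_nonneg_quadratic (b := 1 / 2 * frobNorm (u - v) ^ 2) fun t ht ht1 => ?_
    have hs : (v + t • (u - v)).IsSymm := h.1.add ((hu.sub h.1).smul t)
    have h1 := h.2 hs
    have h2 := penalty_convex_comb hα hα' hlam v u ht.le ht1
    simp only [Set.mem_ofPred_eq] at h1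
    rw [show v + t • (u - v) - x = (v - x) + t • (u - v) by module, frobNorm_add_smul_sq,
      show v - x = (-1 : ℝ) • (x - v) by module, frobInner_smul_left] at h1
    set a := frobInner (x - v) (u - v)
    set b := frobNorm (u - v) ^ 2
    set c := frobNorm ((-1 : ℝ) • (x - v)) ^ 2
    have h3 : penalty α lam v + 1 / (2 * γ) * c ≤ penalty α lam v + t * (penalty α lam u -
      penalty α lam v) + 1 / (2 * γ) * (c + 2 * t * (-1 * a) + t ^ 2 * b) := by linarith
    have h4 := mul_le_mul_of_nonneg_left h3 hγ.le
    have h5 : γ * (1 / (2 * γ)) = 1 / 2 := by field_simp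
    have h6 : ∀ y, γ * (1 / (2 * γ) * y) = 1 / 2 * y := fun y => by rw [← mul_assoc, h5]
    rw [mul_add, mul_add, h6, h6] at h4
    linarith
  linarith

/-- Testing each variational inequality at the other point and adding cancels the penalties;
Cauchy–Schwarz finishes. -/
lemma ProxVI.frobNorm_sub_le {γ α lam : ℝ} {x v x' v' : Matrix (Fin p) (Fin p) ℝ}
    (h : ProxVI γ α lam x v) (h' : ProxVI γ α lam x' v') :
    frobNorm (v - v') ≤ frobNorm (x - x') := by
  have h1 := h.2 v' h'.1
  have h2 := h'.2 v h.1
  have h3 : frobNorm (v - v') ^ 2 ≤ frobNorm (x - x') * frobNorm (v - v') := by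
    refine le_trans ?_ (frobInner_le_frobNorm_mul _ _)
    rw [frobNorm_sq]
    simp only [frobInner_sub_left, frobInner_sub_right] at *
    linarith
  by_contra! hlt
  nlinarith [frobNorm_nonneg (x - x')]

/-- Test the variational inequality in the rank-one direction `w wᵀ` and let its length tend to `0`.
This turns it into spectral information on `v`. -/
lemma ProxVI.quadForm_sub_le {γ α lam : ℝ} (hγ : 0 ≤ γ) (hα : 0 < α) (hlam : 0 < lam)
    {x v : Matrix (Fin p) (Fin p) ℝ}
    (h : ProxVI γ α lam x v) (w : Fin p → ℝ) :
    w ⬝ᵥ (x - v) *ᵥ w ≤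
      γ * (lam₁ α lam * p * (w ⬝ᵥ w) + 2 * lam₂ α lam * (w ⬝ᵥ v *ᵥ w)) := by
  set H := Matrix.vecMulVec w w with hH
  have hHs : H.IsSymm := by
    rw [Matrix.IsSymm, hH, Matrix.transpose_vecMulVec]
  have key : 0 ≤ γ * (lam₁ α lam * entryNorm H + 2 * lam₂ α lam * frobInner v H)
      - frobInner (x - v) H := by
    refine nonneg_of_forall_nonneg_quadratic (b := γ * (lam₂ α lam * frobNorm H ^ 2))
      fun t ht _ => ?_
    have h1 := h.2 (v + t • H) (h.1.add (hHs.smul t))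
    rw [add_sub_cancel_left, frobInner_smul_right] at h1
    have h2 := mul_le_mul_of_nonneg_left (penalty_add_smul_le hα hlam v H ht.le) hγ
    linarith
  rw [hH, frobInner_vecMulVec, frobInner_vecMulVec] at key
  have h3 := mul_le_mul_of_nonneg_left (mul_le_mul_of_nonneg_left (entryNorm_vecMulVec_le w)
    (show 0 ≤ lam₁ α lam from (mul_pos hα hlam).le)) hγ
  linarith

/-! ### The solution satisfies the variational inequality -/

lemma neg_frobNorm_mul_le_quadForm (A : Matrix (Fin p) (Fin p) ℝ) (w : Fin p → ℝ) :
    -(frobNorm A * (w ⬝ᵥ w)) ≤ w ⬝ᵥ A *ᵥ w := by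
  have := quadForm_le_frobNorm (-A) w
  rw [Matrix.neg_mulVec, dotProduct_neg, ← norm_toVec, map_neg, norm_neg, norm_toVec] at this
  linarith

lemma exists_pos_posSemidef_sub {A : Matrix (Fin p) (Fin p) ℝ} (hA : A.PosDef) :
    ∃ a : ℝ, 0 < a ∧ (A - a • (1 : Matrix (Fin p) (Fin p) ℝ)).PosSemidef := by
  -- The `+ 1` keeps the constant positive even for `p = 0`.
  have hh : 0 < frobNorm A⁻¹ + 1 := by linarith [frobNorm_nonneg A⁻¹]
  refine ⟨_, inv_pos.2 hh, ?_⟩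
  have := posSemidef_inv_sub hA.inv hh (by linarith)
  rwa [Matrix.nonsing_inv_nonsing_inv _ ((Matrix.isUnit_iff_isUnit_det A).1 hA.isUnit)] at this

lemma eventually_posDef_add_smul {A H : Matrix (Fin p) (Fin p) ℝ} (hA : A.PosDef)
    (hH : H.IsSymm) : ∀ᶠ t : ℝ in 𝓝[>] 0, (A + t • H).PosDef := by
  obtain ⟨a, ha, hAa⟩ := exists_pos_posSemidef_sub hA
  have h1 : ∀ᶠ t : ℝ in 𝓝[>] 0, t * frobNorm H < a := by
    have : Tendsto (fun t : ℝ => t * frobNorm H) (𝓝[>] 0) (𝓝 (0 * frobNorm H)) :=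
      (Continuous.tendsto (by fun_prop) 0).mono_left nhdsWithin_le_nhds
    rw [zero_mul] at this
    exact this.eventually_lt_const ha
  filter_upwards [h1, self_mem_nhdsWithin] with t ht ht0
  have ht0 : (0 : ℝ) < t := ht0
  refine posDef_of_posSemidef_sub (c := a - t * frobNorm H) (by linarith) ?_
  rw [posSemidef_sub_smul_one_iff (isSymm_of_posDef hA)] at hAa
  rw [posSemidef_sub_smul_one_iff ((isSymm_of_posDef hA).add (hH.smul t))]
  intro w
  rw [Matrix.add_mulVec, Matrix.smul_mulVec, dotProduct_add, dotProduct_smul, smul_eq_mul]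
  nlinarith [hAa w, mul_le_mul_of_nonneg_left (neg_frobNorm_mul_le_quadForm H w) ht0.le]

/-- After factoring out `det A`, `det (1 + t M)` is `1 + t tr M` plus `t²` times a polynomial in
`t`. -/
lemma hasDerivAt_log_det_add_smul {A : Matrix (Fin p) (Fin p) ℝ} (hA : A.PosDef)
    (H : Matrix (Fin p) (Fin p) ℝ) :
    HasDerivAt (fun t : ℝ => Real.log (A + t • H).det) (A⁻¹ * H).trace 0 := by
  have hdet : IsUnit A.det := (Matrix.isUnit_iff_isUnit_det A).1 hA.isUnit
  have h1 : ∀ t : ℝ, (A + t • H).det = A.det * (1 + t • (A⁻¹ * H)).det := by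
    intro t
    rw [← Matrix.det_mul, mul_add, mul_one, mul_smul_comm, ← mul_assoc,
      Matrix.mul_nonsing_inv _ hdet, one_mul]
  have h2 : HasDerivAt (fun t : ℝ => (A + t • H).det) (A.det * (A⁻¹ * H).trace) 0 := by
    obtain ⟨q, hq⟩ : ∃ q : Polynomial ℝ, ∀ t : ℝ,
        (1 + t • (A⁻¹ * H)).det = 1 + (A⁻¹ * H).trace * t + q.eval t * t ^ 2 :=
      ⟨_, fun t => Matrix.det_one_add_smul t _⟩
    simp only [h1, hq]
    have hq' := (q.hasDerivAt 0).mul (hasDerivAt_pow 2 (0 : ℝ))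
    have hl := ((hasDerivAt_id (0 : ℝ)).const_mul (A⁻¹ * H).trace).const_add 1
    have := (hl.add hq').const_mul A.det
    refine this.congr_deriv ?_
    simp
  have h3 := h2.log (by simpa using hdet.ne_zero)
  simpa [hdet.ne_zero] using h3

/-- The minimizer is a fixed point of the exact proximal gradient map, for every step size. Along
the segment to `u` the penalty is replaced by its chord, which leaves a differentiable function
whose right derivative at the minimum is nonnegative. -/
lemma IsSolution.proxVI {S : Matrix (Fin p) (Fin p) ℝ} (hS : S.IsSymm) {γ α lam : ℝ} (hγ : 0 ≤ γ)
    (hα : 0 < α) (hα' : α ≤ 1) (hlam : 0 < lam) {v : Matrix (Fin p) (Fin p) ℝ}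
    (h : IsSolution S α lam v) : ProxVI γ α lam (v - γ • (S - v⁻¹)) v := by
  have hv : v.IsSymm := isSymm_of_posDef h.1
  refine ⟨hv, fun u hu => ?_⟩
  set H := u - v
  have hH : H.IsSymm := hu.sub hv
  set c := penalty α lam u - penalty α lam v
  have hd : HasDerivAt (fun t : ℝ => -Real.log (v + t • H).det + ((v * S).trace
      + t * ((H * S).trace + c))) (-(v⁻¹ * H).trace + ((H * S).trace + c)) 0 := by
    have := (hasDerivAt_log_det_add_smul h.1 H).neg.add
      (((hasDerivAt_id (0 : ℝ)).mul_const ((H * S).trace + c)).const_add (v * S).trace)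
    exact this.congr_deriv (by simp)
  have key := HasDerivAt.nonneg_of_eventually_le hd (by
    filter_upwards [eventually_posDef_add_smul h.1 hH, Ioc_mem_nhdsGT (zero_lt_one' ℝ)] with t ht ht1
    have h1 := h.2 ht
    have h2 := penalty_convex_comb hα hα' hlam v u ht1.1.le ht1.2
    simp only [objective, Set.mem_ofPred_eq, add_mul, smul_mul_assoc, Matrix.trace_add,
      Matrix.trace_smul, smul_eq_mul] at h1
    simp only [zero_smul, add_zero, zero_mul]
    change penalty α lam (v + t • H) ≤ penalty α lam v + t * c at h2
    linarith)
  have e1 : frobInner (v - γ • (S - v⁻¹) - v) H = γ * ((v⁻¹ * H).trace - (H * S).trace) := by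
    rw [show v - γ • (S - v⁻¹) - v = γ • (v⁻¹ - S) by module, frobInner_smul_left,
      frobInner_sub_left, frobInner_eq_trace, frobInner_eq_trace, hS, Matrix.trace_mul_comm S,
      isSymm_of_posDef h.1.inv]
  rw [e1]
  exact mul_le_mul_of_nonneg_left (by linarith) hγ

/-! ### Eigenvalue bounds -/

lemma quadForm_le_specNorm (A : Matrix (Fin p) (Fin p) ℝ) (w : Fin p → ℝ) :
    w ⬝ᵥ A *ᵥ w ≤ specNorm A * (w ⬝ᵥ w) := by
  have h1 := Matrix.inner_toEuclideanCLM A (WithLp.toLp 2 w) (WithLp.toLp 2 w)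
  have h2 : w ⬝ᵥ w = ‖WithLp.toLp 2 w‖ ^ 2 := by
    rw [EuclideanSpace.real_norm_sq_eq]; simp [dotProduct, sq]
  rw [h2]
  refine (h1.symm.trans_le (real_inner_le_norm _ _)).trans ?_
  have := (Matrix.toEuclideanCLM (𝕜 := ℝ) A).le_opNorm (WithLp.toLp 2 w)
  unfold specNorm
  nlinarith [norm_nonneg (WithLp.toLp 2 w)]

lemma posSemidef_sub_smul_one_iff_spectrum {A : Matrix (Fin p) (Fin p) ℝ} (hA : A.IsSymm) (c : ℝ) :
    (A - c • (1 : Matrix (Fin p) (Fin p) ℝ)).PosSemidef ↔ ∀ x ∈ spectrum ℝ A, c ≤ x := by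
  have hs : (A - c • (1 : Matrix (Fin p) (Fin p) ℝ)).IsHermitian := by
    rw [Matrix.IsHermitian, Matrix.conjTranspose_eq_transpose_of_trivial]
    exact hA.sub (Matrix.isSymm_one.smul c)
  rw [Matrix.posSemidef_iff_isHermitian_and_spectrum_nonneg, and_iff_right hs,
    ← Algebra.algebraMap_eq_smul_one, ← spectrum.sub_singleton_eq]
  simp [Set.subset_def]

lemma spectrum_nonempty {A : Matrix (Fin p) (Fin p) ℝ} (hp : 0 < p) (hA : A.IsSymm) :
    (spectrum ℝ A).Nonempty := by
  have hs : A.IsHermitian := by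
    rw [Matrix.IsHermitian, Matrix.conjTranspose_eq_transpose_of_trivial]; exact hA
  rw [hs.spectrum_real_eq_range_eigenvalues]
  have : Nonempty (Fin p) := ⟨⟨0, hp⟩⟩
  exact Set.range_nonempty _

lemma le_eigMin_iff {A : Matrix (Fin p) (Fin p) ℝ} (hp : 0 < p) (hA : A.IsSymm) (c : ℝ) :
    c ≤ eigMin A ↔ (A - c • (1 : Matrix (Fin p) (Fin p) ℝ)).PosSemidef := by
  rw [posSemidef_sub_smul_one_iff_spectrum hA, eigMin,
    le_csInf_iff Matrix.finite_real_spectrum.bddBelow (spectrum_nonempty hp hA)]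

lemma eigMax_le_frobNorm {A : Matrix (Fin p) (Fin p) ℝ} (hp : 0 < p) (hA : A.IsSymm) :
    eigMax A ≤ frobNorm A := by
  refine csSup_le (spectrum_nonempty hp hA) fun x hx => ?_
  have h1 : (-A - (-frobNorm A) • (1 : Matrix (Fin p) (Fin p) ℝ)).PosSemidef := by
    rw [posSemidef_sub_smul_one_iff hA.neg]
    intro w
    have := quadForm_le_frobNorm A w
    rw [Matrix.neg_mulVec, dotProduct_neg]
    linarith
  rw [posSemidef_sub_smul_one_iff_spectrum hA.neg] at h1
  have := h1 (-x) (by simpa [← spectrum.neg_eq] using hx)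
  linarith

/-! ### The constant `ℓ⋆` -/

lemma lam₂_nonneg {α lam : ℝ} (hα' : α ≤ 1) (hlam : 0 < lam) : 0 ≤ lam₂ α lam := by
  have : 0 ≤ 1 - α := by linarith
  unfold lam₂; positivity

lemma mu_pos (S : Matrix (Fin p) (Fin p) ℝ) {α lam ε : ℝ} (hp : 0 < p) (hα : 0 < α)
    (hlam : 0 < lam) (hε : 0 ≤ ε) : 0 < mu S α lam ε := by
  have h1 : 0 ≤ specNorm S := norm_nonneg _
  have h2 : 0 < lam₁ α lam := mul_pos hα hlam
  have h3 : (0 : ℝ) < p := by exact_mod_cast hp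
  unfold mu; positivity

lemma ellStar_pos (S : Matrix (Fin p) (Fin p) ℝ) {α lam ε : ℝ} (hp : 0 < p) (hα : 0 < α)
    (hlam : 0 < lam) (hε : 0 ≤ ε) : 0 < ellStar S α lam ε := by
  have hm := mu_pos S hp hα hlam hε
  unfold ellStar
  split_ifs with h
  · have h2 : 0 < lam₂ α lam := by unfold lam₂; nlinarith
    have : mu S α lam ε < √(mu S α lam ε ^ 2 + 8 * lam₂ α lam) :=
      Real.lt_sqrt_of_sq_lt (by linarith)
    have : 0 < -mu S α lam ε + √(mu S α lam ε ^ 2 + 8 * lam₂ α lam) := by linarith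
    positivity
  · positivity

/-- The quadratic equation is all that is used of the formula for `ℓ⋆`. It also covers `α = 1`,
where `λ₂ = 0`. In the form `1 / ℓ = μ + 2 λ₂ ℓ` it is the balance that the step preserves. -/
lemma ellStar_eq (S : Matrix (Fin p) (Fin p) ℝ) {α lam ε : ℝ} (hp : 0 < p) (hα : 0 < α)
    (hα' : α ≤ 1) (hlam : 0 < lam) (hε : 0 ≤ ε) :
    2 * lam₂ α lam * ellStar S α lam ε ^ 2 + mu S α lam ε * ellStar S α lam ε = 1 := by
  have hm := mu_pos S hp hα hlam hε
  unfold ellStar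
  split_ifs with h
  · have h2 : 0 < lam₂ α lam := by unfold lam₂; nlinarith
    have h3 : √(mu S α lam ε ^ 2 + 8 * lam₂ α lam) ^ 2 = mu S α lam ε ^ 2 + 8 * lam₂ α lam :=
      Real.sq_sqrt (by positivity)
    set r := √(mu S α lam ε ^ 2 + 8 * lam₂ α lam)
    field_simp
    linear_combination 2 * h3
  · have : α = 1 := le_antisymm hα' (not_lt.1 h)
    subst this
    simp [lam₂, hm.ne']

/-- The proximal gradient step keeps the spectrum above `ℓ⋆(ε)` if the noise is at most `ε`. -/
lemma posSemidef_step {S : Matrix (Fin p) (Fin p) ℝ} {α lam ε γ : ℝ} (hp : 0 < p) (hα : 0 < α)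
    (hα' : α ≤ 1) (hlam : 0 < lam) (hε : 0 ≤ ε) (hγ : 0 < γ) (hγ' : γ ≤ ellStar S α lam ε ^ 2)
    {T C v : Matrix (Fin p) (Fin p) ℝ} (hT : T.PosDef)
    (hTl : (T - ellStar S α lam ε • (1 : Matrix (Fin p) (Fin p) ℝ)).PosSemidef)
    (hC : ∀ i j, |(C - T⁻¹) i j| ≤ ε) (hv : ProxVI γ α lam (T - γ • (S - C)) v) :
    (v - ellStar S α lam ε • (1 : Matrix (Fin p) (Fin p) ℝ)).PosSemidef := by
  rw [posSemidef_sub_smul_one_iff hv.1]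
  rw [posSemidef_sub_smul_one_iff (isSymm_of_posDef hT)] at hTl
  intro w
  have hl := ellStar_pos S hp hα hlam hε
  have hleq := ellStar_eq S hp hα hα' hlam hε
  have h2 := lam₂_nonneg hα' hlam
  set l := ellStar S α lam ε
  set n := w ⬝ᵥ w with hn
  have hn0 : 0 ≤ n := dotProduct_self_nonneg' w
  have q1 := hv.quadForm_sub_le hγ.le hα hlam w
  have q2 := hTl w
  -- The tangent to `x ↦ 1 / x` at `x = l`, the point where the bound must be sharp.
  have q3 := quadForm_inv_ge hT l⁻¹ w
  have q4 := quadForm_le_specNorm S w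
  have q5 : -(ε * (p * n)) ≤ w ⬝ᵥ (C - T⁻¹) *ᵥ w := by
    rw [← frobInner_vecMulVec]
    refine le_trans ?_ (neg_le_of_abs_le (abs_frobInner_le (B := Matrix.vecMulVec w w) hC))
    exact neg_le_neg (mul_le_mul_of_nonneg_left (entryNorm_vecMulVec_le w) hε)
  rw [Matrix.sub_mulVec, dotProduct_sub] at q5
  rw [Matrix.sub_mulVec, Matrix.sub_mulVec, Matrix.smul_mulVec, Matrix.sub_mulVec, dotProduct_sub,
    dotProduct_sub, dotProduct_smul, dotProduct_sub, smul_eq_mul] at q1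
  rw [← hn] at *
  set a := w ⬝ᵥ T *ᵥ w
  set b := w ⬝ᵥ T⁻¹ *ᵥ w
  set s := w ⬝ᵥ S *ᵥ w
  set c := w ⬝ᵥ C *ᵥ w
  set y := w ⬝ᵥ v *ᵥ w
  have hmu : mu S α lam ε = l⁻¹ - 2 * lam₂ α lam * l := by
    field_simp
    linarith
  have hmu' : mu S α lam ε * n = specNorm S * n + (lam₁ α lam * p * n + ε * (p * n)) := by
    unfold mu; ring
  have r1 : γ * (s - c) ≤ γ * (specNorm S * n - b + ε * (p * n)) :=
    mul_le_mul_of_nonneg_left (by linarith) hγ.le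
  have r2 : a - γ * (specNorm S * n - b + ε * (p * n)) - γ * (lam₁ α lam * p * n)
      ≤ (1 + 2 * γ * lam₂ α lam) * y := by linarith
  have r3 : γ * (2 * l⁻¹ * n - l⁻¹ ^ 2 * a) ≤ γ * b := mul_le_mul_of_nonneg_left q3 hγ.le
  have r4 : a - γ * (mu S α lam ε * n) + γ * (2 * l⁻¹ * n - l⁻¹ ^ 2 * a)
      ≤ (1 + 2 * γ * lam₂ α lam) * y := by rw [hmu']; linarith
  -- After the tangent bound the coefficient of `a` is `1 - γ / l²`. It is nonnegative because `γ ≤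
  -- l²`, so `a` may be replaced by `l n`.
  have r5 : 0 ≤ (1 - γ * l⁻¹ ^ 2) * (a - l * n) := by
    refine mul_nonneg ?_ (by linarith)
    have : γ * l⁻¹ ^ 2 ≤ l ^ 2 * l⁻¹ ^ 2 := by gcongr
    rw [← mul_pow, mul_inv_cancel₀ hl.ne'] at this
    linarith
  have r6 : (1 + 2 * γ * lam₂ α lam) * (l * n) ≤ (1 + 2 * γ * lam₂ α lam) * y := by
    refine le_trans ?_ r4
    rw [hmu]
    have e : γ * l⁻¹ ^ 2 * (l * n) = γ * l⁻¹ * n := by field_simp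
    nlinarith
  exact le_of_mul_le_mul_left r6 (by positivity)

/-- The solution has spectrum above `ℓ⋆(ε)`. -/
lemma IsSolution.posSemidef_sub {S : Matrix (Fin p) (Fin p) ℝ} (hS : S.IsSymm) {α lam ε : ℝ}
    (hp : 0 < p) (hα : 0 < α) (hα' : α ≤ 1) (hlam : 0 < lam) (hε : 0 ≤ ε)
    {v : Matrix (Fin p) (Fin p) ℝ} (h : IsSolution S α lam v) :
    (v - ellStar S α lam ε • (1 : Matrix (Fin p) (Fin p) ℝ)).PosSemidef := by
  rw [posSemidef_sub_smul_one_iff (isSymm_of_posDef h.1)]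
  intro w
  have hl := ellStar_pos S hp hα hlam hε
  have hleq := ellStar_eq S hp hα hα' hlam hε
  have h2 := lam₂_nonneg hα' hlam
  set l := ellStar S α lam ε
  set n := w ⬝ᵥ w with hn
  have hn0 : 0 ≤ n := dotProduct_self_nonneg' w
  have q1 := (h.proxVI hS zero_le_one hα hα' hlam).quadForm_sub_le zero_le_one hα hlam w
  have q3 := quadForm_inv_ge h.1 l⁻¹ w
  have q4 := quadForm_le_specNorm S w
  rw [show v - (1 : ℝ) • (S - v⁻¹) - v = v⁻¹ - S by module, Matrix.sub_mulVec,
    dotProduct_sub] at q1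
  rw [← hn] at *
  set b := w ⬝ᵥ v⁻¹ *ᵥ w
  set y := w ⬝ᵥ v *ᵥ w
  have hmu : mu S α lam ε = l⁻¹ - 2 * lam₂ α lam * l := by
    field_simp
    linarith
  have hmu' : mu S α lam ε * n = specNorm S * n + (lam₁ α lam * p * n + ε * p * n) := by
    unfold mu; ring
  -- There is no noise at the fixed point, so the `ε p` inside `mu` is mere slack.
  have hεn : 0 ≤ ε * p * n := by positivity
  have r : (l⁻¹ ^ 2 + 2 * lam₂ α lam) * (l * n) ≤ (l⁻¹ ^ 2 + 2 * lam₂ α lam) * y := by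
    have e : l⁻¹ ^ 2 * (l * n) = l⁻¹ * n := by field_simp
    rw [hmu] at hmu'
    nlinarith
  exact le_of_mul_le_mul_left r (by positivity)

/-! ### Existence of the solution -/

lemma isClosed_posSemidef : IsClosed {A : Matrix (Fin p) (Fin p) ℝ | A.PosSemidef} := by
  simp only [posSemidef_iff_isSymm, Set.ofPred_and, Matrix.IsSymm, Set.ofPred_forall]
  refine (isClosed_eq (by fun_prop) continuous_id).inter (isClosed_iInter fun w => ?_)
  exact isClosed_le continuous_const (by fun_prop)

lemma quadForm_single_add_single (A : Matrix (Fin p) (Fin p) ℝ) (i j : Fin p) (c : ℝ) :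
    (Pi.single i 1 + Pi.single j c) ⬝ᵥ A *ᵥ (Pi.single i 1 + Pi.single j c) =
      A i i + c * A i j + c * A j i + c ^ 2 * A j j := by
  simp only [Matrix.mulVec_add, dotProduct_add, add_dotProduct, single_dotProduct,
    Matrix.mulVec_single, Matrix.col_apply, Pi.smul_apply, MulOpposite.smul_eq_mul_unop,
    MulOpposite.unop_op]
  ring

/-- Positivity at `e_i ± e_j` gives `2 |A i j| ≤ A i i + A j j`, and each diagonal entry is at most
the trace. -/
lemma abs_entry_le_trace {A : Matrix (Fin p) (Fin p) ℝ} (hA : A.PosSemidef) (i j : Fin p) :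
    |A i j| ≤ A.trace := by
  have hd : ∀ k, A k k ≤ A.trace := fun k =>
    Finset.single_le_sum (f := fun k => A k k) (fun k _ => hA.diag_nonneg) (Finset.mem_univ k)
  obtain ⟨hs, hq⟩ := posSemidef_iff_isSymm.1 hA
  have h1 := hq (Pi.single i 1 + Pi.single j 1)
  have h2 := hq (Pi.single i 1 + Pi.single j (-1))
  rw [quadForm_single_add_single, hs.apply i j] at h1 h2
  rw [abs_le]
  constructor <;> linarith [hd i, hd j]

/-- Apply `log x ≤ x - 1` to `a` times each eigenvalue. The slope `a` stays free so that it can be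
set below the slope `λ₁` of the penalty. -/
lemma log_det_le {A : Matrix (Fin p) (Fin p) ℝ} (hA : A.PosDef) {a : ℝ} (ha : 0 < a) :
    Real.log A.det ≤ a * A.trace - p * (1 + Real.log a) := by
  have hd := hA.eigenvalues_pos
  rw [hA.isHermitian.det_eq_prod_eigenvalues, hA.isHermitian.trace_eq_sum_eigenvalues]
  simp only [RCLike.ofReal_real_eq_id, id_eq]
  rw [Real.log_prod (fun i _ => (hd i).ne')]
  have : ∀ i ∈ Finset.univ, Real.log (hA.isHermitian.eigenvalues i) ≤
      a * hA.isHermitian.eigenvalues i - (1 + Real.log a) := fun i _ => by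
    have := Real.log_le_sub_one_of_pos (mul_pos ha (hd i))
    rw [Real.log_mul ha.ne' (hd i).ne'] at this
    linarith
  refine (Finset.sum_le_sum this).trans_eq ?_
  rw [Finset.sum_sub_distrib, Finset.mul_sum, Finset.sum_const, Finset.card_univ, Fintype.card_fin,
    nsmul_eq_mul]

lemma trace_le_entryNorm (A : Matrix (Fin p) (Fin p) ℝ) : A.trace ≤ entryNorm A :=
  Finset.sum_le_sum fun i _ => (le_abs_self _).trans
    (Finset.single_le_sum (f := fun j => |A i j|) (fun _ _ => abs_nonneg _) (Finset.mem_univ i))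

lemma continuousOn_objective (S : Matrix (Fin p) (Fin p) ℝ) (α lam : ℝ) :
    ContinuousOn (objective S α lam) {A | A.det ≠ 0} := by
  have h1 : Continuous (penalty (p := p) α lam) := by
    unfold penalty
    fun_prop
  have h2 : ContinuousOn (fun A : Matrix (Fin p) (Fin p) ℝ => Real.log A.det) {A | A.det ≠ 0} :=
    ContinuousOn.log (by fun_prop) fun _ h => h
  exact (h2.neg.add (by fun_prop)).add h1.continuousOn

lemma exists_isSolution {S : Matrix (Fin p) (Fin p) ℝ} (hS : S.PosSemidef) {α lam : ℝ}
    (hα : 0 < α) (hα' : α ≤ 1) (hlam : 0 < lam) :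
    ∃ A : Matrix (Fin p) (Fin p) ℝ, IsSolution S α lam A := by
  have hl1 : 0 < lam₁ α lam := mul_pos hα hlam
  have hl2 := lam₂_nonneg hα' hlam
  set c₀ := objective S α lam 1
  set b := 2 / lam₁ α lam * (c₀ - p * (1 + Real.log (lam₁ α lam / 2)))
  -- `K` contains the sublevel set at the identity. The determinant bound keeps it off the boundary
  -- of the cone; the trace bound comes from spending half of `λ₁ tr A` on the log determinant, and
  -- it bounds all entries.
  set K : Set (Matrix (Fin p) (Fin p) ℝ) :=
    {A | A.PosSemidef ∧ Real.exp (-c₀) ≤ A.det ∧ A.trace ≤ b} with hK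
  have hsub : ∀ A : Matrix (Fin p) (Fin p) ℝ, A.PosDef → objective S α lam A ≤ c₀ → A ∈ K := by
    intro A hA hle
    have h1 := trace_mul_nonneg_of_posSemidef hA.posSemidef hS
    have h2 := mul_le_mul_of_nonneg_left (trace_le_entryNorm A) hl1.le
    have h3 : 0 ≤ lam₂ α lam * frobNorm A ^ 2 := by positivity
    have h4 := log_det_le hA (half_pos hl1)
    have h5 := mul_nonneg hl1.le hA.posSemidef.trace_nonneg
    rw [objective, penalty_eq] at hle
    refine ⟨hA.posSemidef, ?_, ?_⟩
    · rw [← Real.le_log_iff_exp_le hA.det_pos]; linarith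
    · rw [show b = 2 / lam₁ α lam * (c₀ - p * (1 + Real.log (lam₁ α lam / 2))) from rfl]
      have h6 : lam₁ α lam / 2 * A.trace ≤ c₀ - p * (1 + Real.log (lam₁ α lam / 2)) := by linarith
      have h7 := mul_le_mul_of_nonneg_left h6 (show 0 ≤ 2 / lam₁ α lam by positivity)
      refine le_trans (le_of_eq ?_) h7
      field_simp
  have hdet : ∀ A ∈ K, A.PosDef := fun A hA => by
    have hd : A.det ≠ 0 := ((Real.exp_pos _).trans_le hA.2.1).ne'
    exact hA.1.posDef_iff_isUnit.2 ((Matrix.isUnit_iff_isUnit_det A).2 hd.isUnit)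
  have hcl : IsClosed K := by
    simp only [hK, Set.ofPred_and]
    exact isClosed_posSemidef.inter ((isClosed_le continuous_const (by fun_prop)).inter
      (isClosed_le (by fun_prop) continuous_const))
  have hcomp : IsCompact K := by
    refine IsCompact.of_isClosed_subset
      (isCompact_univ_pi fun _ : Fin p => isCompact_univ_pi fun _ : Fin p =>
        isCompact_Icc (a := -b) (b := b)) hcl fun A hA i _ j _ =>
        abs_le.1 ((abs_entry_le_trace hA.1 i j).trans hA.2.2)
  have h1K : (1 : Matrix (Fin p) (Fin p) ℝ) ∈ K := hsub 1 Matrix.PosDef.one le_rfl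
  obtain ⟨A, hAK, hA⟩ := hcomp.exists_isMinOn ⟨1, h1K⟩
    ((continuousOn_objective S α lam).mono fun A hA => (hdet A hA).det_pos.ne')
  refine ⟨A, hdet A hAK, fun u hu => ?_⟩
  by_cases h : objective S α lam u ≤ c₀
  · exact hA (hsub u hu h)
  · exact (hA h1K).trans (not_le.1 h).le

/-! ### One step of the algorithm -/

section Step

variable {S : Matrix (Fin p) (Fin p) ℝ} {α lam ε γ : ℝ}

/-- Nonexpansiveness against the fixed point `u` leaves the difference of the gradient steps, which
is the contraction of `add_smul_inv_sub` plus the error. The factor `1/2` comes from `√(1 - x) ≤ 1 -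
x / 2`. -/
lemma frobNorm_step_sub_le (hS : S.IsSymm) (hp : 0 < p) (hα : 0 < α)
    (hα' : α ≤ 1) (hlam : 0 < lam) (hε : 0 ≤ ε) (hγ : 0 < γ) (hγ' : γ ≤ ellStar S α lam ε ^ 2)
    {u T C v : Matrix (Fin p) (Fin p) ℝ} (hu : IsSolution S α lam u) (hT : T.PosDef)
    (hTl : (T - ellStar S α lam ε • (1 : Matrix (Fin p) (Fin p) ℝ)).PosSemidef)
    (hv : ProxVI γ α lam (T - γ • (S - C)) v) {a b : ℝ} (ha : 0 < a) (hb : 0 < b)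
    (hTa : frobNorm T ≤ a) (hub : frobNorm u ≤ b) :
    frobNorm (v - u) ≤ (1 - γ / (2 * (a * b))) * frobNorm (T - u)
      + γ * frobNorm (C - T⁻¹) := by
  refine (hv.frobNorm_sub_le (hu.proxVI hS hγ.le hα hα' hlam)).trans ?_
  rw [show T - γ • (S - C) - (u - γ • (S - u⁻¹))
    = ((T + γ • T⁻¹) - (u + γ • u⁻¹)) + γ • (C - T⁻¹) by module, add_smul_inv_sub hT hu.1]
  refine (frobNorm_add_le _ _).trans ?_
  rw [frobNorm_smul, abs_of_pos hγ]
  gcongr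
  have key := frobNorm_sub_smul_mul_mul_sq_le (X := T - u) hT hu.1 hγ.le hγ'
    (ellStar_pos S hp hα hlam hε).le hTl (hu.posSemidef_sub hS hp hα hα' hlam hε) ha hb hTa hub
  set Y := frobNorm (T - u - γ • (T⁻¹ * (T - u) * u⁻¹))
  have hY : 0 ≤ Y := frobNorm_nonneg _
  have hR : 0 ≤ frobNorm (T - u) := frobNorm_nonneg _
  set R := frobNorm (T - u)
  have hx : γ / (2 * (a * b)) = γ / (a * b) / 2 := by field_simp
  rw [hx]
  set x := γ / (a * b)
  -- That `x ≤ 1` is read off from `0 ≤ Y² ≤ (1 - x) R²`, which requires `R ≠ 0`.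
  rcases hR.eq_or_lt with h0 | h0
  · rw [← h0] at key ⊢
    nlinarith
  · have hx1 : x ≤ 1 := by
      by_contra! hlt
      nlinarith [sq_nonneg Y, mul_pos (sub_pos.2 hlt) (pow_pos h0 2)]
    refine (pow_le_pow_iff_left₀ hY (mul_nonneg (by linarith) hR) two_ne_zero).1 (key.trans ?_)
    nlinarith [sq_nonneg (x * R)]

lemma frobNorm_pos_of_posDef (hp : 0 < p) {A : Matrix (Fin p) (Fin p) ℝ} (hA : A.PosDef) :
    0 < frobNorm A := by
  refine (frobNorm_nonneg A).lt_of_ne fun h => ?_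
  have h1 := hA.diag_pos (i := ⟨0, hp⟩)
  rw [eq_zero_of_frobNorm_eq_zero h.symm] at h1
  simp at h1

/-- Along the algorithm the squared distance to the solution, truncated from below, grows at most
by a factor `1 + K ‖C - T⁻¹‖²`. -/
lemma exists_step_growth (hS : S.IsSymm) (hp : 0 < p) (hα : 0 < α)
    (hα' : α ≤ 1) (hlam : 0 < lam) (hε : 0 ≤ ε) (hγ : 0 < γ) (hγ' : γ ≤ ellStar S α lam ε ^ 2)
    {u : Matrix (Fin p) (Fin p) ℝ} (hu : IsSolution S α lam u) :
    ∃ b K : ℝ, 0 < b ∧ 0 < K ∧ frobNorm u ≤ b ∧ ∀ T C v : Matrix (Fin p) (Fin p) ℝ, T.PosDef →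
      (T - ellStar S α lam ε • (1 : Matrix (Fin p) (Fin p) ℝ)).PosSemidef →
      ProxVI γ α lam (T - γ • (S - C)) v →
      max (frobNorm (v - u)) b ^ 2 ≤
        max (frobNorm (T - u)) b ^ 2 * (1 + K * frobNorm (C - T⁻¹) ^ 2) := by
  set h := frobNorm u with hh
  have h0 : 0 < h := frobNorm_pos_of_posDef hp hu.1
  -- For `R ≥ h` the contraction gain `γ R / (2 (h + R) h)` is at least `c`, since `h + R ≤ 2 R`:
  -- the drift towards `u` does not fade at infinity.
  set c := γ / (4 * h) with hc
  have hc0 : 0 < c := by positivity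
  set b := h + c with hb
  have hb0 : 0 < b := by positivity
  refine ⟨b, γ ^ 2 * (2 / (c * b) + 1 / b ^ 2), hb0, by positivity, by linarith,
    fun T C v hT hTl hv => ?_⟩
  set R := frobNorm (T - u) with hR
  have hR0 : 0 ≤ R := frobNorm_nonneg _
  have hTn : frobNorm T ≤ h + R := by
    have := frobNorm_add_le u (T - u)
    rwa [add_sub_cancel] at this
  have key := frobNorm_step_sub_le hS hp hα hα' hlam hε hγ hγ' hu hT hTl hv
    (by positivity : 0 < h + R) h0 hTn le_rfl
  set D := frobNorm (C - T⁻¹) with hD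
  set ξ := γ * D with hξ
  have hξ0 : 0 ≤ ξ := mul_nonneg hγ.le (frobNorm_nonneg _)
  set W := max R b with hW
  have hWb : b ≤ W := le_max_right _ _
  have hWR : R ≤ W := le_max_left _ _
  have hW0 : 0 < W := hb0.trans_le hWb
  -- Only the part of the noise that exceeds the drift counts, and it is at most `ξ² / c`. The
  -- absence of a linear term is why summability of `1 / N`, rather than of `1 / √N`, is enough.
  set η := max (ξ - c) 0 with hη
  have hη0 : 0 ≤ η := le_max_right _ _
  have hη1 : ξ - c ≤ η := le_max_left _ _
  have hη2 : η ≤ ξ := max_le (by linarith) hξ0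
  have hη3 : η ≤ ξ ^ 2 / c := by
    refine max_le ?_ (by positivity)
    rw [le_div_iff₀ hc0]
    nlinarith [sq_nonneg (ξ - c), mul_nonneg hξ0 hc0.le]
  have hstep : max (frobNorm (v - u)) b ≤ W + η := by
    refine max_le (key.trans ?_) (by linarith)
    rw [sub_mul, one_mul]
    rcases le_total h R with hle | hle
    · have : c ≤ γ / (2 * ((h + R) * h)) * R := by
        rw [hc, div_mul_eq_mul_div, div_le_div_iff₀ (by positivity) (by positivity)]
        have := mul_le_mul_of_nonneg_left hle (mul_pos hγ h0).le
        nlinarith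
      linarith
    -- Near `u` there is no drift to use, but `R + ξ ≤ h + c + (ξ - c)`; this dictates `b = h + c`.
    · have : 0 ≤ γ / (2 * ((h + R) * h)) * R := by positivity
      linarith
  have h1 : max (frobNorm (v - u)) b ^ 2 ≤ (W + η) ^ 2 :=
    pow_le_pow_left₀ (hb0.le.trans (le_max_right _ _)) hstep 2
  refine h1.trans ?_
  have h2 : 2 * W * η ≤ W ^ 2 * (2 / (c * b) * ξ ^ 2) := by
    have e1 : 2 * W * η ≤ 2 * W * (ξ ^ 2 / c) := by gcongr
    have e2 : 2 * W * (ξ ^ 2 / c) = W * b * (2 / (c * b) * ξ ^ 2) := by field_simp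
    have e3 : W * b * (2 / (c * b) * ξ ^ 2) ≤ W * W * (2 / (c * b) * ξ ^ 2) := by gcongr
    rw [sq W]; linarith
  have h3 : η ^ 2 ≤ W ^ 2 * (1 / b ^ 2 * ξ ^ 2) := by
    have e1 : η ^ 2 ≤ ξ ^ 2 := by gcongr
    have e2 : ξ ^ 2 = b ^ 2 * (1 / b ^ 2 * ξ ^ 2) := by field_simp
    have e3 : b ^ 2 * (1 / b ^ 2 * ξ ^ 2) ≤ W ^ 2 * (1 / b ^ 2 * ξ ^ 2) := by gcongr
    linarith
  have h4 : W ^ 2 * (1 + γ ^ 2 * (2 / (c * b) + 1 / b ^ 2) * D ^ 2) =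
      W ^ 2 + W ^ 2 * (2 / (c * b) * ξ ^ 2) + W ^ 2 * (1 / b ^ 2 * ξ ^ 2) := by
    rw [hξ]; ring
  rw [h4]
  nlinarith

/-- The iterates converge to the solution if they stay bounded and the noise vanishes. -/
lemma tendsto_of_noise_tendsto_zero (hS : S.IsSymm) (hp : 0 < p) (hα : 0 < α)
    (hα' : α ≤ 1) (hlam : 0 < lam) (hε : 0 ≤ ε) (hγ : 0 < γ) (hγ' : γ ≤ ellStar S α lam ε ^ 2)
    {u : Matrix (Fin p) (Fin p) ℝ} (hu : IsSolution S α lam u)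
    {T C : ℕ → Matrix (Fin p) (Fin p) ℝ} (hT : ∀ k, (T k).PosDef)
    (hTl : ∀ k, (T k - ellStar S α lam ε • (1 : Matrix (Fin p) (Fin p) ℝ)).PosSemidef)
    (hstep : ∀ k, ProxVI γ α lam (T k - γ • (S - C k)) (T (k + 1)))
    {B : ℝ} (hB : ∀ k, frobNorm (T k) ≤ B)
    (hC : Tendsto (fun k => frobNorm (C k - (T k)⁻¹)) atTop (𝓝 0)) :
    Tendsto T atTop (𝓝 u) := by
  have h0 : 0 < frobNorm u := frobNorm_pos_of_posDef hp hu.1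
  have hB0 : 0 < B := (frobNorm_pos_of_posDef hp (hT 0)).trans_le (hB 0)
  -- The bound `B` makes the contraction rate uniform in `k`; capping it at `1` keeps the factor `1
  -- - r` nonnegative.
  obtain ⟨r, hr0, hr1, hr⟩ : ∃ r, 0 < r ∧ r ≤ 1 ∧ r ≤ γ / (2 * (B * frobNorm u)) :=
    ⟨min 1 (γ / (2 * (B * frobNorm u))), lt_min one_pos (by positivity), min_le_left _ _,
      min_le_right _ _⟩
  have key : ∀ k, frobNorm (T (k + 1) - u) ≤ (1 - r) * frobNorm (T k - u)
      + γ * frobNorm (C k - (T k)⁻¹) := fun k =>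
    (frobNorm_step_sub_le hS hp hα hα' hlam hε hγ hγ' hu (hT k) (hTl k) (hstep k) hB0 h0 (hB k)
      le_rfl).trans (by gcongr; exact frobNorm_nonneg _)
  have hbd : ∀ k, frobNorm (T k - u) ≤ B + frobNorm u := fun k => by
    have := frobNorm_add_le (T k) ((-1 : ℝ) • u)
    rw [frobNorm_smul, neg_one_smul, ← sub_eq_add_neg] at this
    simp only [abs_neg, abs_one, one_mul] at this
    linarith [hB k]
  set f := fun k => frobNorm (T k - u) with hf
  have hf0 : ∀ k, 0 ≤ f k := fun k => frobNorm_nonneg _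
  have hfb : IsBoundedUnder (· ≤ ·) atTop f := isBoundedUnder_of ⟨_, hbd⟩
  have hfc : IsCoboundedUnder (· ≤ ·) atTop f :=
    (isBoundedUnder_of ⟨0, hf0⟩ : IsBoundedUnder (· ≥ ·) atTop f).isCoboundedUnder_le
  set L := limsup f atTop with hL
  have hL0 : 0 ≤ L := le_limsup_of_frequently_le (Frequently.of_forall hf0) hfb
  have hLle : L ≤ 0 := by
    by_contra! hpos
    -- A positive limsup `L` would decrease under one step: `(1 - r)(L + r L / 4) + r L / 4 ≤ L - r
    -- L / 4`.
    have e1 : ∀ᶠ k in atTop, f k < L + r * L / 4 :=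
      eventually_lt_of_limsup_lt (by nlinarith [mul_pos hr0 hpos]) hfb
    have e2 : ∀ᶠ k in atTop, γ * frobNorm (C k - (T k)⁻¹) < r * L / 4 := by
      have := hC.const_mul γ
      rw [mul_zero] at this
      exact this.eventually_lt_const (by positivity)
    have e3 : ∀ᶠ k in atTop, f (k + 1) ≤ L - r * L / 4 := by
      filter_upwards [e1, e2] with k h1 h2
      have h3 := key k
      have h4 := frobNorm_nonneg (T (k + 1) - u)
      change f (k + 1) ≤ (1 - r) * f k + _ at h3
      nlinarith [mul_le_mul_of_nonneg_left h1.le (sub_nonneg.2 hr1), mul_pos hr0 hpos,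
        mul_pos hr0 (mul_pos hr0 hpos)]
    have e4 : ∀ᶠ k in atTop, f k ≤ L - r * L / 4 := by
      rw [eventually_atTop] at e3 ⊢
      obtain ⟨n, hn⟩ := e3
      refine ⟨n + 1, fun k hk => ?_⟩
      obtain ⟨m, rfl⟩ : ∃ m, k = m + 1 := ⟨k - 1, by omega⟩
      exact hn m (by omega)
    have := limsup_le_of_le hfc e4
    nlinarith [mul_pos hr0 hpos]
  have hlim : Tendsto f atTop (𝓝 0) := by
    refine tendsto_of_le_liminf_of_limsup_le ?_ hLle hfb
      (isBoundedUnder_of ⟨0, hf0⟩)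
    exact le_liminf_of_le hfb.isCoboundedUnder_ge (Eventually.of_forall hf0)
  refine tendsto_pi_nhds.2 fun i => tendsto_pi_nhds.2 fun j => ?_
  rw [tendsto_iff_norm_sub_tendsto_zero]
  exact squeeze_zero (fun _ => norm_nonneg _) (fun k => abs_entry_le_frobNorm (T k - u) i j) hlim

end Step

/-! ### Averages of squares of independent standard Gaussian variables -/

/-- The law of `n` independent standard Gaussian variables. -/
noncomputable abbrev stdGaussianPi (n : ℕ) : Measure (Fin n → ℝ) := Measure.pi fun _ => gaussianReal 0 1

/-- The centred average of squares. -/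
noncomputable def centredAvgSq {n : ℕ} (g : Fin n → ℝ) : ℝ := (n : ℝ)⁻¹ * ∑ j, g j ^ 2 - 1

lemma measurable_centredAvgSq (n : ℕ) : Measurable (centredAvgSq (n := n)) := by
  unfold centredAvgSq; fun_prop

lemma integral_exp_mul_sq_gaussianReal {s : ℝ} (hs : s < 1 / 2) :
    ∫ x, Real.exp (s * x ^ 2) ∂gaussianReal 0 1 = (√(1 - 2 * s))⁻¹ := by
  rw [integral_gaussianReal_eq_integral_smul one_ne_zero]
  have : ∀ x : ℝ, gaussianPDFReal 0 1 x • Real.exp (s * x ^ 2)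
      = (√(2 * Real.pi))⁻¹ * Real.exp (-(1 / 2 - s) * x ^ 2) := fun x => by
    simp only [gaussianPDFReal_def, NNReal.coe_one, mul_one, sub_zero, smul_eq_mul]
    rw [mul_assoc, ← Real.exp_add]
    congr 2; ring
  simp_rw [this]
  rw [integral_const_mul, integral_gaussian, ← Real.sqrt_inv, ← Real.sqrt_mul (by positivity),
    ← Real.sqrt_inv]
  congr 1
  have h1 : 1 / 2 - s ≠ 0 := by linarith
  have h2 : 1 - 2 * s ≠ 0 := by linarith
  field_simp

/-- The Bochner integral of a nonintegrable function is `0`, but the value computed above is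
positive. -/
lemma integrable_exp_mul_sq_gaussianReal {s : ℝ} (hs : s < 1 / 2) :
    Integrable (fun x => Real.exp (s * x ^ 2)) (gaussianReal 0 1) := by
  by_contra h
  have h1 := integral_undef h
  rw [integral_exp_mul_sq_gaussianReal hs] at h1
  have h2 : 0 < 1 - 2 * s := by linarith
  exact (by positivity : (√(1 - 2 * s))⁻¹ ≠ 0) h1

lemma exp_mul_sum_sq {n : ℕ} (s : ℝ) (g : Fin n → ℝ) :
    Real.exp (s * ∑ j, g j ^ 2) = ∏ j, Real.exp (s * g j ^ 2) := by
  rw [← Real.exp_sum, Finset.mul_sum]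

lemma integrable_exp_mul_sum_sq {n : ℕ} {s : ℝ} (hs : s < 1 / 2) :
    Integrable (fun g : Fin n → ℝ => Real.exp (s * ∑ j, g j ^ 2)) (stdGaussianPi n) := by
  simp_rw [exp_mul_sum_sq]
  exact Integrable.fintype_prod (f := fun (_ : Fin n) (x : ℝ) => Real.exp (s * x ^ 2))
    fun _ => integrable_exp_mul_sq_gaussianReal hs

lemma mgf_sum_sq {n : ℕ} {s : ℝ} (hs : s < 1 / 2) :
    mgf (fun g : Fin n → ℝ => ∑ j, g j ^ 2) (stdGaussianPi n) s =
      Real.exp (-(n * Real.log (1 - 2 * s) / 2)) := by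
  have h2 : 0 < 1 - 2 * s := by linarith
  simp_rw [mgf, exp_mul_sum_sq]
  rw [integral_fintype_prod_eq_pow (fun x : ℝ => Real.exp (s * x ^ 2)),
    integral_exp_mul_sq_gaussianReal hs, Fintype.card_fin, inv_pow, Real.exp_neg,
    ← Real.exp_log (Real.sqrt_pos.2 h2), ← Real.exp_nat_mul, Real.log_sqrt h2.le]
  congr 2; ring

/-- The upper-tail Chernoff exponent is `n (t - log (1 + t)) / 2`; the inequality says that it
dominates `n min(1, t² / 16)`. -/
lemma log_one_add_le {t : ℝ} (ht : 0 ≤ t) : Real.log (1 + t) ≤ t - 2 * min 1 (t ^ 2 / 16) := by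
  -- The tangent to `log` at `5`, with `log 5 - 1` rounded up; it serves for `t ≥ 2`.
  have key : Real.log (1 + t) ≤ (1 + t) / 5 + 0.637 := by
    have h1 : Real.log (1 + t) = Real.log ((1 + t) / 5) + Real.log 5 := by
      rw [← Real.log_mul (by positivity) (by norm_num)]; congr 1; ring
    have h2 := Real.log_le_sub_one_of_pos (show 0 < (1 + t) / 5 by positivity)
    have h3 : Real.log 5 = 2 * Real.log 2 + Real.log (5 / 4) := by
      rw [show (5 : ℝ) = 2 ^ 2 * (5 / 4) by norm_num, Real.log_mul (by norm_num) (by norm_num),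
        Real.log_pow]
      norm_num
    have h4 := Real.log_le_sub_one_of_pos (show (0 : ℝ) < 5 / 4 by norm_num)
    have h5 := Real.log_two_lt_d9
    linarith
  rcases le_total t 2 with h | h
  · have h1 : Real.log (1 + t) = 2 * Real.log √(1 + t) := by
      rw [Real.log_sqrt (by positivity)]; ring
    have hp : 0 < √(1 + t) := Real.sqrt_pos.2 (by positivity)
    have h2 := Real.log_le_sub_one_of_pos hp
    have h3 : √(1 + t) ^ 2 = 1 + t := Real.sq_sqrt (by positivity)
    set y := √(1 + t)
    have hy1 : 1 ≤ y := by nlinarith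
    -- `9 / 5` is above `√3` and still satisfies `(y + 1)² ≤ 8`.
    have hy2 : y ≤ 9 / 5 := by nlinarith
    have ht' : t = y ^ 2 - 1 := by linarith
    have h4 : 2 * min 1 (t ^ 2 / 16) ≤ t ^ 2 / 8 := by linarith [min_le_right 1 (t ^ 2 / 16)]
    have h5 : t ^ 2 / 8 ≤ (y - 1) ^ 2 := by
      have : t ^ 2 = (y - 1) ^ 2 * (y + 1) ^ 2 := by rw [ht']; ring
      have h8 : (y + 1) ^ 2 ≤ 8 := by nlinarith
      nlinarith [mul_le_mul_of_nonneg_left h8 (sq_nonneg (y - 1))]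
    nlinarith
  · rcases le_total t 4 with h' | h'
    · have h4 : 2 * min 1 (t ^ 2 / 16) ≤ t ^ 2 / 8 := by linarith [min_le_right 1 (t ^ 2 / 16)]
      nlinarith
    · have h4 : 2 * min 1 (t ^ 2 / 16) ≤ 2 := by linarith [min_le_left 1 (t ^ 2 / 16)]
      linarith

lemma sub_sq_div_two_le_log_one_add {t : ℝ} (ht : 0 ≤ t) : t - t ^ 2 / 2 ≤ Real.log (1 + t) := by
  refine le_trans ?_ (Real.le_log_one_add_of_nonneg ht)
  rw [le_div_iff₀ (by positivity)]
  nlinarith [pow_nonneg ht 3]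

/-- Concentration of the average of squares of independent standard Gaussian variables. -/
lemma measure_centredAvgSq_gt_le {n : ℕ} (hn : 0 < n) {t : ℝ} (ht : 0 ≤ t) :
    stdGaussianPi n {g | t < |centredAvgSq g|} ≤
      2 * ENNReal.ofReal (Real.exp (-(min 1 (t ^ 2 / 16) * n))) := by
  have hn' : (0 : ℝ) < n := by exact_mod_cast hn
  set e := Real.exp (-(min 1 (t ^ 2 / 16) * n)) with he
  have hup : (stdGaussianPi n).real {g : Fin n → ℝ | n * (1 + t) ≤ ∑ j, g j ^ 2} ≤ e := by
    -- The optimal Chernoff parameter: it solves `1 / (1 - 2 s) = 1 + t`.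
    have hs0 : 0 ≤ t / (2 * (1 + t)) := by positivity
    have hs : t / (2 * (1 + t)) < 1 / 2 := by
      rw [div_lt_div_iff₀ (by positivity) (by positivity)]; linarith
    refine (measure_ge_le_exp_mul_mgf _ hs0 (integrable_exp_mul_sum_sq hs)).trans ?_
    have e1 : 1 - 2 * (t / (2 * (1 + t))) = (1 + t)⁻¹ := by field_simp; ring
    rw [mgf_sum_sq hs, ← Real.exp_add, he, Real.exp_le_exp, e1, Real.log_inv]
    have e2 : -(t / (2 * (1 + t))) * (n * (1 + t)) = -(n * t / 2) := by field_simp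
    rw [e2]
    nlinarith [mul_le_mul_of_nonneg_left (log_one_add_le ht) hn'.le]
  have hlo : (stdGaussianPi n).real {g : Fin n → ℝ | ∑ j, g j ^ 2 ≤ n * (1 - t)} ≤ e := by
    -- A simple parameter suffices for the lower tail: the exponent is at most `-n t² / 4`.
    have hs0 : -(t / 2) ≤ 0 := by linarith
    have hs : -(t / 2) < 1 / 2 := by linarith
    refine (measure_le_le_exp_mul_mgf _ hs0 (integrable_exp_mul_sum_sq hs)).trans ?_
    rw [mgf_sum_sq hs, ← Real.exp_add, he, Real.exp_le_exp,
      show 1 - 2 * -(t / 2) = 1 + t by ring]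
    have h1 := mul_le_mul_of_nonneg_left (sub_sq_div_two_le_log_one_add ht) hn'.le
    have h2 := mul_le_mul_of_nonneg_right (min_le_right 1 (t ^ 2 / 16)) hn'.le
    nlinarith [mul_nonneg hn'.le (sq_nonneg t)]
  have hsub : {g : Fin n → ℝ | t < |centredAvgSq g|} ⊆
      {g | n * (1 + t) ≤ ∑ j, g j ^ 2} ∪ {g | ∑ j, g j ^ 2 ≤ n * (1 - t)} := by
    intro g hg
    have hg : t < |(n : ℝ)⁻¹ * ∑ j, g j ^ 2 - 1| := hg
    have hx : ∑ j, g j ^ 2 = n * ((n : ℝ)⁻¹ * ∑ j, g j ^ 2) := by field_simp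
    rcases lt_abs.1 hg with h | h
    · left
      change n * (1 + t) ≤ ∑ j, g j ^ 2
      rw [hx]; exact mul_le_mul_of_nonneg_left (by linarith) hn'.le
    · right
      change ∑ j, g j ^ 2 ≤ n * (1 - t)
      rw [hx]; exact mul_le_mul_of_nonneg_left (by linarith) hn'.le
  have conv : ∀ s : Set (Fin n → ℝ), (stdGaussianPi n).real s ≤ e →
      stdGaussianPi n s ≤ ENNReal.ofReal e := fun s hs => by
    rw [← ofReal_measureReal]; exact ENNReal.ofReal_le_ofReal hs
  calc _ ≤ _ := measure_mono hsub
    _ ≤ _ := measure_union_le _ _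
    _ ≤ ENNReal.ofReal e + ENNReal.ofReal e := add_le_add (conv _ hup) (conv _ hlo)
    _ = _ := (two_mul _).symm

lemma memLp_sq_sub_one : MemLp (fun x : ℝ => x ^ 2 - 1) 2 (gaussianReal 0 1) := by
  have h4 : MemLp (fun x : ℝ => x ^ 2) 2 (gaussianReal 0 1) := by
    rw [memLp_two_iff_integrable_sq (by fun_prop)]
    have := (memLp_id_gaussianReal (μ := 0) (v := 1) 4).integrable_norm_pow (p := 4) (by norm_num)
    refine this.congr (Eventually.of_forall fun x => ?_)
    simp only [id_eq, Real.norm_eq_abs]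
    rw [← pow_mul, Even.pow_abs (by decide)]
  exact h4.sub (memLp_const 1)

/-- The variance of the average of squares is of order `1 / n`. -/
lemma lintegral_centredAvgSq_sq_le {n : ℕ} (hn : 0 < n) :
    ∫⁻ g, ENNReal.ofReal (centredAvgSq g ^ 2) ∂stdGaussianPi n ≤
      ENNReal.ofReal (Var[fun x : ℝ => x ^ 2 - 1; gaussianReal 0 1] / n) := by
  have hn' : (n : ℝ) ≠ 0 := by exact_mod_cast hn.ne'
  set Y : Fin n → ℝ → ℝ := fun _ x => (n : ℝ)⁻¹ * (x ^ 2 - 1) with hY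
  have hYm : ∀ i, MemLp (Y i) 2 (gaussianReal 0 1) := fun i => memLp_sq_sub_one.const_mul _
  have heq : (fun g : Fin n → ℝ => centredAvgSq g) = ∑ i, fun g : Fin n → ℝ => Y i (g i) := by
    ext g
    simp only [centredAvgSq, hY, Finset.sum_apply, ← Finset.mul_sum, Finset.sum_sub_distrib]
    simp [mul_sub, hn']
  have hmean : ∫ x : ℝ, (x ^ 2 - 1) ∂gaussianReal 0 1 = 0 := by
    have h1 : Var[id; gaussianReal 0 1] = ∫ x : ℝ, id x ^ 2 ∂gaussianReal 0 1 :=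
      variance_of_integral_eq_zero aemeasurable_id integral_id_gaussianReal
    rw [variance_id_gaussianReal] at h1
    have h2 : Integrable (fun x : ℝ => x ^ 2) (gaussianReal 0 1) := by
      simpa using (memLp_id_gaussianReal (μ := 0) (v := 1) 2).integrable_sq
    rw [integral_sub h2 (integrable_const _)]
    simp only [id_eq] at h1
    rw [← h1]; simp
  have hYi : ∀ i, Integrable (fun g : Fin n → ℝ => Y i (g i)) (stdGaussianPi n) := fun i =>
    integrable_comp_eval (μ := fun _ : Fin n => gaussianReal 0 1) (f := Y i)
      ((hYm i).integrable (by norm_num))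
  have hint0 : ∫ g, centredAvgSq g ∂stdGaussianPi n = 0 := by
    have : ∀ g : Fin n → ℝ, centredAvgSq g = ∑ i, Y i (g i) := fun g => by
      simpa using congrFun heq g
    simp_rw [this]
    rw [integral_finsetSum _ fun i _ => hYi i]
    refine Finset.sum_eq_zero fun i _ => ?_
    rw [integral_comp_eval (μ := fun _ : Fin n => gaussianReal 0 1) (f := Y i)
      (hYm i).aestronglyMeasurable]
    rw [hY]
    simp only
    rw [integral_const_mul, hmean, mul_zero]
  have hvar : Var[fun g : Fin n → ℝ => centredAvgSq g; stdGaussianPi n] =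
      Var[fun x : ℝ => x ^ 2 - 1; gaussianReal 0 1] / n := by
    rw [heq, variance_sum_pi hYm]
    simp only [hY, variance_const_mul, Finset.sum_const, Finset.card_univ, Fintype.card_fin,
      nsmul_eq_mul]
    field_simp
  have hmem : MemLp (fun g : Fin n → ℝ => centredAvgSq g) 2 (stdGaussianPi n) := by
    rw [heq]
    exact memLp_finsetSum' _ fun i _ =>
      (hYm i).comp_measurePreserving (measurePreserving_eval (fun _ : Fin n => gaussianReal 0 1) i)
  rw [← ofReal_integral_eq_lintegral_ofReal hmem.integrable_sq
    (Eventually.of_forall fun _ => sq_nonneg _), ← variance_of_integral_eq_zero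
    (measurable_centredAvgSq n).aemeasurable hint0, hvar]

/-! ### Empirical covariances of Gaussian batches -/

/-- The law of a batch of size `n`. -/
noncomputable abbrev batchLaw (n : ℕ) (A : Matrix (Fin p) (Fin p) ℝ) :
    Measure (Fin n → EuclideanSpace ℝ (Fin p)) :=
  Measure.pi fun _ => multivariateGaussian 0 A

/-- A linear functional of a centred Gaussian vector is centred Gaussian with variance `dᵀ A d`.
Writing it as a scaled standard variable includes the degenerate case of variance `0`. -/
lemma map_dotProduct_multivariateGaussian {A : Matrix (Fin p) (Fin p) ℝ} (hA : A.PosSemidef)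
    (d : Fin p → ℝ) :
    (multivariateGaussian 0 A).map (fun w => d ⬝ᵥ w.ofLp) =
      (gaussianReal 0 1).map (fun x => √(d ⬝ᵥ A *ᵥ d) * x) := by
  have hv : 0 ≤ d ⬝ᵥ A *ᵥ d := (posSemidef_iff_isSymm.1 hA).2 d
  have h1 : (fun w : EuclideanSpace ℝ (Fin p) => d ⬝ᵥ w.ofLp) =
      innerSL ℝ (WithLp.toLp 2 d) := by
    ext w
    simp [PiLp.inner_apply, dotProduct, mul_comm]
  have h2 : Var[innerSL ℝ (WithLp.toLp 2 d); multivariateGaussian 0 A] = d ⬝ᵥ A *ᵥ d :=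
    (covarianceBilin_self IsGaussian.memLp_two_id _).symm.trans
      (covarianceBilin_multivariateGaussian hA _ _)
  rw [h1, IsGaussian.map_eq_gaussianReal, h2,
    ContinuousLinearMap.integral_comp_id_comm IsGaussian.integrable_id,
    integral_id_multivariateGaussian, map_zero, gaussianReal_map_const_mul, mul_zero]
  congr 1
  ext
  simp [Real.coe_toNNReal _ hv, Real.sq_sqrt hv]

lemma map_dotProduct_batchLaw {A : Matrix (Fin p) (Fin p) ℝ} (hA : A.PosSemidef)
    (d : Fin p → ℝ) (n : ℕ) :
    (batchLaw n A).map (fun w j => d ⬝ᵥ (w j).ofLp) =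
      (stdGaussianPi n).map (fun g j => √(d ⬝ᵥ A *ᵥ d) * g j) := by
  have hm : Measurable fun w : EuclideanSpace ℝ (Fin p) => d ⬝ᵥ w.ofLp := by
    simp only [dotProduct]; fun_prop
  have hp1 := Measure.isProbabilityMeasure_map (μ := multivariateGaussian 0 A) hm.aemeasurable
  have hm2 : Measurable fun x : ℝ => √(d ⬝ᵥ A *ᵥ d) * x := by fun_prop
  have hp2 := Measure.isProbabilityMeasure_map (μ := gaussianReal 0 1) hm2.aemeasurable
  rw [Measure.pi_map_pi (f := fun (_ : Fin n) (w : EuclideanSpace ℝ (Fin p)) => d ⬝ᵥ w.ofLp)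
    fun _ => hm.aemeasurable, Measure.pi_map_pi
    (f := fun (_ : Fin n) (x : ℝ) => √(d ⬝ᵥ A *ᵥ d) * x) fun _ => hm2.aemeasurable]
  simp_rw [map_dotProduct_multivariateGaussian hA]

lemma quadForm_empCov {n : ℕ} (d : Fin p → ℝ) (w : Fin n → EuclideanSpace ℝ (Fin p)) :
    d ⬝ᵥ empCov w *ᵥ d = (n : ℝ)⁻¹ * ∑ j, (d ⬝ᵥ (w j).ofLp) ^ 2 := by
  simp only [empCov, Matrix.smul_mulVec, dotProduct_smul, Matrix.sum_mulVec, dotProduct_sum,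
    smul_eq_mul]
  congr 1
  refine Finset.sum_congr rfl fun j _ => ?_
  rw [Matrix.vecMulVec_mulVec, dotProduct_smul, dotProduct_comm (w j).ofLp d]
  simp [sq]

lemma measurable_dotProduct_batch (d : Fin p → ℝ) (n : ℕ) :
    Measurable fun (w : Fin n → EuclideanSpace ℝ (Fin p)) (j : Fin n) => d ⬝ᵥ (w j).ofLp := by
  simp only [dotProduct]; fun_prop

/-- The error of a quadratic form of the empirical covariance is a multiple of a centred average
of squares. -/
lemma lintegral_quadForm_empCov_sub {A : Matrix (Fin p) (Fin p) ℝ} (hA : A.PosSemidef)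
    (d : Fin p → ℝ) {n : ℕ} (hn : 0 < n) {f : ℝ → ℝ≥0∞} (hf : Measurable f) :
    ∫⁻ w, f (d ⬝ᵥ (empCov w - A) *ᵥ d) ∂batchLaw n A =
      ∫⁻ g, f ((d ⬝ᵥ A *ᵥ d) * centredAvgSq g) ∂stdGaussianPi n := by
  have hn' : (n : ℝ) ≠ 0 := by exact_mod_cast hn.ne'
  set v := d ⬝ᵥ A *ᵥ d with hvdef
  have hv : 0 ≤ v := (posSemidef_iff_isSymm.1 hA).2 d
  set F : (Fin n → ℝ) → ℝ≥0∞ := fun x => f ((n : ℝ)⁻¹ * ∑ j, x j ^ 2 - v) with hF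
  have hFm : Measurable F := hf.comp (by fun_prop)
  have h1 := congrArg (fun m => ∫⁻ x, F x ∂m) (map_dotProduct_batchLaw hA d n)
  simp only at h1
  rw [lintegral_map hFm (measurable_dotProduct_batch d n), lintegral_map hFm (by fun_prop)] at h1
  convert h1 using 3 with w g g
  · rw [hF]
    simp only
    rw [Matrix.sub_mulVec, dotProduct_sub, quadForm_empCov]
  · rw [hF]
    simp only [mul_pow, Real.sq_sqrt hv, ← Finset.mul_sum, ← hvdef, centredAvgSq]
    congr 1; ring

lemma measure_quadForm_empCov_sub_gt_le {A : Matrix (Fin p) (Fin p) ℝ} (hA : A.PosSemidef)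
    (d : Fin p → ℝ) {n : ℕ} (hn : 0 < n) {t m : ℝ} (ht : 0 ≤ t) (hm : 0 ≤ m)
    (hd : d ⬝ᵥ A *ᵥ d ≤ m) :
    batchLaw n A {w | m * t < |d ⬝ᵥ (empCov w - A) *ᵥ d|} ≤
      2 * ENNReal.ofReal (Real.exp (-(min 1 (t ^ 2 / 16) * n))) := by
  have hms : MeasurableSet {x : ℝ | m * t < |x|} := measurableSet_lt measurable_const (by fun_prop)
  have hmw : Measurable fun w : Fin n → EuclideanSpace ℝ (Fin p) =>
      d ⬝ᵥ (empCov w - A) *ᵥ d := by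
    simp only [Matrix.sub_mulVec, dotProduct_sub, quadForm_empCov]
    have := measurable_dotProduct_batch (p := p) d n
    fun_prop
  have h := lintegral_quadForm_empCov_sub hA d hn
    (f := Set.indicator {x : ℝ | m * t < |x|} 1) (measurable_one.indicator hms)
  have e1 : ∀ w : Fin n → EuclideanSpace ℝ (Fin p),
      Set.indicator {x : ℝ | m * t < |x|} (1 : ℝ → ℝ≥0∞) (d ⬝ᵥ (empCov w - A) *ᵥ d) =
      Set.indicator {w | m * t < |d ⬝ᵥ (empCov w - A) *ᵥ d|} 1 w := fun _ => rfl
  have e2 : ∀ g : Fin n → ℝ,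
      Set.indicator {x : ℝ | m * t < |x|} (1 : ℝ → ℝ≥0∞) ((d ⬝ᵥ A *ᵥ d) * centredAvgSq g) =
      Set.indicator {g | m * t < |(d ⬝ᵥ A *ᵥ d) * centredAvgSq g|} 1 g := fun _ => rfl
  simp_rw [e1, e2] at h
  have s1 : MeasurableSet {w : Fin n → EuclideanSpace ℝ (Fin p) |
      m * t < |d ⬝ᵥ (empCov w - A) *ᵥ d|} := hmw hms
  have s2 : MeasurableSet {g : Fin n → ℝ | m * t < |(d ⬝ᵥ A *ᵥ d) * centredAvgSq g|} :=
    ((measurable_centredAvgSq n).const_mul _) hms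
  rw [lintegral_indicator_one s1, lintegral_indicator_one s2] at h
  rw [h]
  refine le_trans (measure_mono fun g hg => ?_) (measure_centredAvgSq_gt_le hn ht)
  have hg : m * t < |(d ⬝ᵥ A *ᵥ d) * centredAvgSq g| := hg
  have hv : 0 ≤ d ⬝ᵥ A *ᵥ d := (posSemidef_iff_isSymm.1 hA).2 d
  rw [abs_mul, abs_of_nonneg hv] at hg
  have := hg.trans_le (mul_le_mul_of_nonneg_right hd (abs_nonneg (centredAvgSq g)))
  exact lt_of_mul_lt_mul_left this hm

lemma lintegral_quadForm_empCov_sub_sq_le {A : Matrix (Fin p) (Fin p) ℝ} (hA : A.PosSemidef)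
    (d : Fin p → ℝ) {n : ℕ} (hn : 0 < n) {m : ℝ} (hd : d ⬝ᵥ A *ᵥ d ≤ m) :
    ∫⁻ w, ENNReal.ofReal ((d ⬝ᵥ (empCov w - A) *ᵥ d) ^ 2) ∂batchLaw n A ≤
      ENNReal.ofReal (m ^ 2 * (Var[fun x : ℝ => x ^ 2 - 1; gaussianReal 0 1] / n)) := by
  have hv : 0 ≤ d ⬝ᵥ A *ᵥ d := (posSemidef_iff_isSymm.1 hA).2 d
  rw [lintegral_quadForm_empCov_sub hA d hn (f := fun x => ENNReal.ofReal (x ^ 2)) (by fun_prop),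
    ENNReal.ofReal_mul (sq_nonneg _)]
  simp only [mul_pow, ENNReal.ofReal_mul (sq_nonneg (d ⬝ᵥ A *ᵥ d))]
  rw [lintegral_const_mul _ (by have := measurable_centredAvgSq n; fun_prop)]
  exact mul_le_mul' (ENNReal.ofReal_le_ofReal (pow_le_pow_left₀ hv hd 2))
    (lintegral_centredAvgSq_sq_le hn)

/-! ### Errors of the empirical covariance, entrywise and in Frobenius norm -/

/-- Expand `0 ≤ |w - l A⁻¹ w|²` and use `A ≥ l` at `A⁻¹ w`. -/
lemma quadForm_inv_le {A : Matrix (Fin p) (Fin p) ℝ} {l : ℝ} (hl : 0 < l)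
    (h : (A - l • (1 : Matrix (Fin p) (Fin p) ℝ)).PosSemidef) (w : Fin p → ℝ) :
    w ⬝ᵥ A⁻¹ *ᵥ w ≤ l⁻¹ * (w ⬝ᵥ w) := by
  have hA := posDef_of_posSemidef_sub hl h
  have hdet : IsUnit A.det := (Matrix.isUnit_iff_isUnit_det A).1 hA.isUnit
  rw [posSemidef_sub_smul_one_iff (isSymm_of_posDef hA)] at h
  set y := A⁻¹ *ᵥ w with hy
  have h1 := h y
  have e1 : A *ᵥ y = w := by
    rw [hy, Matrix.mulVec_mulVec, Matrix.mul_nonsing_inv _ hdet, Matrix.one_mulVec]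
  rw [e1, dotProduct_comm y w] at h1
  have h2 := dotProduct_self_nonneg' (w - l • y)
  simp only [sub_dotProduct, dotProduct_sub, smul_dotProduct, dotProduct_smul, smul_eq_mul,
    dotProduct_comm y w] at h2
  rw [← div_eq_inv_mul, le_div_iff₀ hl]
  nlinarith [mul_le_mul_of_nonneg_left h1 hl.le]

lemma isSymm_empCov {n : ℕ} (w : Fin n → EuclideanSpace ℝ (Fin p)) : (empCov w).IsSymm := by
  unfold Matrix.IsSymm empCov
  rw [Matrix.transpose_smul, Matrix.transpose_sum]
  simp [Matrix.transpose_vecMulVec]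

lemma four_mul_entry {A : Matrix (Fin p) (Fin p) ℝ} (hA : A.IsSymm) (i j : Fin p) :
    4 * A i j = (Pi.single i 1 + Pi.single j 1) ⬝ᵥ A *ᵥ (Pi.single i 1 + Pi.single j 1) -
      (Pi.single i 1 + Pi.single j (-1)) ⬝ᵥ A *ᵥ (Pi.single i 1 + Pi.single j (-1)) := by
  rw [quadForm_single_add_single, quadForm_single_add_single, hA.apply i j]
  ring

lemma measure_entry_gt_le {A : Matrix (Fin p) (Fin p) ℝ} {l ε : ℝ} (hl : 0 < l) (hε : 0 < ε)
    (h : (A - l • (1 : Matrix (Fin p) (Fin p) ℝ)).PosSemidef) {n : ℕ} (hn : 0 < n) (i j : Fin p) :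
    batchLaw n A⁻¹ {w | ε < |(empCov w - A⁻¹) i j|} ≤
      4 * ENNReal.ofReal (Real.exp (-(min 1 (ε ^ 2 * l ^ 2 / 16) * n))) := by
  have hA := posDef_of_posSemidef_sub hl h
  rw [← mul_pow]
  set e := ENNReal.ofReal (Real.exp (-(min 1 ((ε * l) ^ 2 / 16) * n))) with he
  rcases eq_or_ne i j with rfl | hij
  · have h1 := measure_quadForm_empCov_sub_gt_le hA.inv.posSemidef (Pi.single i 1) hn
      (mul_pos hε hl).le (inv_pos.2 hl).le (by simpa using quadForm_inv_le hl h (Pi.single i 1))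
    rw [← he] at h1
    have e1 : l⁻¹ * (ε * l) = ε := by field_simp
    rw [e1] at h1
    have e2 : ∀ M : Matrix (Fin p) (Fin p) ℝ, Pi.single i 1 ⬝ᵥ M *ᵥ Pi.single i 1 = M i i :=
      fun M => by simp
    simp only [e2] at h1
    exact h1.trans (by gcongr; norm_num)
  -- Polarization: `e_i ± e_j` has squared length `2`, so both forms have variance at most `2 / l`.
  -- If each error is at most `2 ε`, then `4 |entry| ≤ 4 ε`. Two events with two tails each give the
  -- factor `4`.
  · have hd : ∀ c : ℝ, c ^ 2 = 1 → (Pi.single i 1 + Pi.single j c : Fin p → ℝ) ⬝ᵥ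
        A⁻¹ *ᵥ (Pi.single i 1 + Pi.single j c) ≤ 2 / l := fun c hc => by
      refine (quadForm_inv_le hl h _).trans_eq ?_
      have := quadForm_single_add_single (1 : Matrix (Fin p) (Fin p) ℝ) i j c
      rw [Matrix.one_mulVec] at this
      rw [this]
      simp [hij, hij.symm, hc]
      ring
    have h1 := measure_quadForm_empCov_sub_gt_le hA.inv.posSemidef (Pi.single i 1 + Pi.single j 1)
      hn (mul_pos hε hl).le (by positivity) (hd 1 (by norm_num))
    have h2 := measure_quadForm_empCov_sub_gt_le hA.inv.posSemidef
      (Pi.single i 1 + Pi.single j (-1)) hn (mul_pos hε hl).le (by positivity) (hd (-1) (by norm_num))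
    have e1 : 2 / l * (ε * l) = 2 * ε := by field_simp
    rw [e1, ← he] at h1 h2
    refine (measure_mono fun w hw => ?_).trans ((measure_union_le _ _).trans
      ((add_le_add h1 h2).trans_eq ?_))
    · have hw : ε < |(empCov w - A⁻¹) i j| := hw
      have h4 := four_mul_entry ((isSymm_empCov w).sub (isSymm_of_posDef hA.inv)) i j
      by_contra hcon
      simp only [Set.mem_union, Set.mem_ofPred_eq, not_or, not_lt] at hcon
      have h5 := abs_sub
        ((Pi.single i 1 + Pi.single j 1 : Fin p → ℝ) ⬝ᵥ (empCov w - A⁻¹) *ᵥ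
          (Pi.single i 1 + Pi.single j 1))
        ((Pi.single i 1 + Pi.single j (-1) : Fin p → ℝ) ⬝ᵥ (empCov w - A⁻¹) *ᵥ
          (Pi.single i 1 + Pi.single j (-1)))
      rw [← h4, abs_mul, abs_of_pos (by norm_num : (0 : ℝ) < 4)] at h5
      linarith [hcon.1, hcon.2]
    · rw [← add_mul]; norm_num

lemma measure_exists_entry_gt_le {A : Matrix (Fin p) (Fin p) ℝ} {l ε : ℝ} (hl : 0 < l)
    (hε : 0 < ε) (h : (A - l • (1 : Matrix (Fin p) (Fin p) ℝ)).PosSemidef) {n : ℕ} (hn : 0 < n) :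
    batchLaw n A⁻¹ {w | ∃ i j, ε < |(empCov w - A⁻¹) i j|} ≤
      4 * (p : ℝ≥0∞) ^ 2 *
        ENNReal.ofReal (Real.exp (-(min 1 (ε ^ 2 * l ^ 2 / 16) * n))) := by
  set e := ENNReal.ofReal (Real.exp (-(min 1 (ε ^ 2 * l ^ 2 / 16) * n))) with he
  have hset : {w : Fin n → EuclideanSpace ℝ (Fin p) | ∃ i j, ε < |(empCov w - A⁻¹) i j|} =
      ⋃ i ∈ Finset.univ, ⋃ j ∈ Finset.univ, {w | ε < |(empCov w - A⁻¹) i j|} := by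
    ext w; simp
  rw [hset]
  calc _ ≤ ∑ i : Fin p, batchLaw n A⁻¹ (⋃ j ∈ Finset.univ, {w | ε < |(empCov w - A⁻¹) i j|}) :=
        measure_biUnion_finset_le _ _
    _ ≤ ∑ _i : Fin p, ∑ _j : Fin p, 4 * e := Finset.sum_le_sum fun i _ =>
        (measure_biUnion_finset_le _ _).trans
          (Finset.sum_le_sum fun j _ => measure_entry_gt_le hl hε h hn i j)
    _ = _ := by simp; ring

lemma measurable_empCov (n : ℕ) (i j : Fin p) :
    Measurable fun w : Fin n → EuclideanSpace ℝ (Fin p) => empCov w i j := by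
  simp only [empCov, Matrix.smul_apply, Matrix.sum_apply, Matrix.vecMulVec_apply]
  fun_prop

lemma lintegral_frobNorm_empCov_sub_sq_le {A : Matrix (Fin p) (Fin p) ℝ} {l : ℝ} (hl : 0 < l)
    (h : (A - l • (1 : Matrix (Fin p) (Fin p) ℝ)).PosSemidef) {n : ℕ} (hn : 0 < n) :
    ∫⁻ w, ENNReal.ofReal (frobNorm (empCov w - A⁻¹) ^ 2) ∂batchLaw n A⁻¹ ≤
      ENNReal.ofReal (p ^ 2 * (4 / l ^ 2 * Var[fun x : ℝ => x ^ 2 - 1; gaussianReal 0 1]) / n) := by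
  have hA := posDef_of_posSemidef_sub hl h
  set V := Var[fun x : ℝ => x ^ 2 - 1; gaussianReal 0 1] with hV
  have hV0 : 0 ≤ V := variance_nonneg _ _
  -- The cruder `4 / l` treats the diagonal together with the rest, since `e_i + e_i` has squared
  -- length `4`.
  have hd : ∀ (i j : Fin p) (c : ℝ), |c| = 1 → (Pi.single i 1 + Pi.single j c : Fin p → ℝ) ⬝ᵥ
      A⁻¹ *ᵥ (Pi.single i 1 + Pi.single j c) ≤ 4 / l := fun i j c hc => by
    refine (quadForm_inv_le hl h _).trans ?_
    have := quadForm_single_add_single (1 : Matrix (Fin p) (Fin p) ℝ) i j c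
    rw [Matrix.one_mulVec] at this
    rw [this, ← div_eq_inv_mul]
    gcongr
    have hc2 : c ^ 2 = 1 := by rw [← sq_abs, hc]; norm_num
    rw [Matrix.one_apply_eq, Matrix.one_apply_eq, hc2]
    rcases eq_or_ne i j with rfl | hij
    · rw [Matrix.one_apply_eq]; linarith [le_abs_self c]
    · rw [Matrix.one_apply_ne hij, Matrix.one_apply_ne hij.symm]; linarith
  have hentry : ∀ i j : Fin p,
      ∫⁻ w, ENNReal.ofReal ((empCov w - A⁻¹) i j ^ 2) ∂batchLaw n A⁻¹ ≤
        ENNReal.ofReal (4 / l ^ 2 * V / n) := fun i j => by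
    have h1 := lintegral_quadForm_empCov_sub_sq_le hA.inv.posSemidef _ hn (hd i j 1 (by norm_num))
    have h2 := lintegral_quadForm_empCov_sub_sq_le hA.inv.posSemidef _ hn
      (hd i j (-1) (by norm_num))
    have hm : ∀ d : Fin p → ℝ, Measurable fun w : Fin n → EuclideanSpace ℝ (Fin p) =>
        ENNReal.ofReal ((d ⬝ᵥ (empCov w - A⁻¹) *ᵥ d) ^ 2) := fun d => by
      simp only [Matrix.sub_mulVec, dotProduct_sub, quadForm_empCov]
      have := measurable_dotProduct_batch (p := p) d n
      fun_prop
    -- The entry is `(a - b) / 4`, and `(a - b)² / 16 ≤ (a² + b²) / 8`.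
    have h3 : ∀ w : Fin n → EuclideanSpace ℝ (Fin p),
        ENNReal.ofReal ((empCov w - A⁻¹) i j ^ 2) ≤ ENNReal.ofReal (1 / 8) *
          (ENNReal.ofReal (((Pi.single i 1 + Pi.single j 1 : Fin p → ℝ) ⬝ᵥ
            (empCov w - A⁻¹) *ᵥ (Pi.single i 1 + Pi.single j 1)) ^ 2) +
          ENNReal.ofReal (((Pi.single i 1 + Pi.single j (-1) : Fin p → ℝ) ⬝ᵥ
            (empCov w - A⁻¹) *ᵥ (Pi.single i 1 + Pi.single j (-1))) ^ 2)) := fun w => by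
      rw [← ENNReal.ofReal_add (sq_nonneg _) (sq_nonneg _), ← ENNReal.ofReal_mul (by norm_num)]
      refine ENNReal.ofReal_le_ofReal ?_
      have h4 := four_mul_entry ((isSymm_empCov w).sub (isSymm_of_posDef hA.inv)) i j
      set a := (Pi.single i 1 + Pi.single j 1 : Fin p → ℝ) ⬝ᵥ (empCov w - A⁻¹) *ᵥ
        (Pi.single i 1 + Pi.single j 1)
      set b := (Pi.single i 1 + Pi.single j (-1) : Fin p → ℝ) ⬝ᵥ (empCov w - A⁻¹) *ᵥ
        (Pi.single i 1 + Pi.single j (-1))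
      have h5 : (empCov w - A⁻¹) i j = (a - b) / 4 := by linarith
      rw [h5]
      nlinarith [sq_nonneg (a + b)]
    refine (lintegral_mono h3).trans ?_
    rw [lintegral_const_mul' _ _ ENNReal.ofReal_ne_top, lintegral_add_left (hm _)]
    refine (mul_le_mul_right (add_le_add h1 h2) _).trans_eq ?_
    rw [← ENNReal.ofReal_add (by positivity) (by positivity), ← ENNReal.ofReal_mul (by norm_num)]
    congr 1; ring
  have hme : ∀ i j : Fin p, Measurable fun w : Fin n → EuclideanSpace ℝ (Fin p) =>
      ENNReal.ofReal ((empCov w - A⁻¹) i j ^ 2) := fun i j => by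
    have := measurable_empCov (p := p) n i j
    simp only [Matrix.sub_apply]
    fun_prop
  have hsum' : ∀ f : Fin p → Fin p → ℝ,
      ENNReal.ofReal (∑ i, ∑ j, f i j ^ 2) = ∑ i, ∑ j, ENNReal.ofReal (f i j ^ 2) := fun f => by
    rw [ENNReal.ofReal_sum_of_nonneg fun i _ => Finset.sum_nonneg fun j _ => sq_nonneg _]
    exact Finset.sum_congr rfl fun i _ => ENNReal.ofReal_sum_of_nonneg fun j _ => sq_nonneg _
  have hsum : ∀ w : Fin n → EuclideanSpace ℝ (Fin p),
      ENNReal.ofReal (frobNorm (empCov w - A⁻¹) ^ 2) =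
        ∑ i, ∑ j, ENNReal.ofReal ((empCov w - A⁻¹) i j ^ 2) := fun w => by
    rw [frobNorm_sq_eq_sum]; exact hsum' fun i j => (empCov w - A⁻¹) i j
  simp_rw [hsum]
  rw [lintegral_finsetSum _ fun i _ => Finset.measurable_sum _ fun j _ => hme i j]
  calc _ = ∑ i, ∑ j, ∫⁻ w, ENNReal.ofReal ((empCov w - A⁻¹) i j ^ 2) ∂batchLaw n A⁻¹ :=
        Finset.sum_congr rfl fun i _ => lintegral_finsetSum _ fun j _ => hme i j
    _ ≤ ∑ _i : Fin p, ∑ _j : Fin p, ENNReal.ofReal (4 / l ^ 2 * V / n) :=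
        Finset.sum_le_sum fun i _ => Finset.sum_le_sum fun j _ => hentry i j
    _ = _ := by
        simp only [Finset.sum_const, Finset.card_univ, Fintype.card_fin, nsmul_eq_mul]
        rw [← mul_assoc, ← ENNReal.ofReal_natCast, ← ENNReal.ofReal_mul (by positivity),
          ← ENNReal.ofReal_mul (by positivity)]
        congr 1; ring

/-! ### Measurability of the law of a batch -/

/-- The product σ-algebra on matrices. -/
local instance matrixMeasurableSpace : MeasurableSpace (Matrix (Fin p) (Fin p) ℝ) :=
  inferInstanceAs (MeasurableSpace (Fin p → Fin p → ℝ))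

local instance : BorelSpace (Matrix (Fin p) (Fin p) ℝ) :=
  inferInstanceAs (BorelSpace (Fin p → Fin p → ℝ))

local instance : PolishSpace (Matrix (Fin p) (Fin p) ℝ) :=
  inferInstanceAs (PolishSpace (Fin p → Fin p → ℝ))

lemma measurable_entry (i j : Fin p) : Measurable fun A : Matrix (Fin p) (Fin p) ℝ => A i j :=
  (continuous_id.matrix_elem i j).measurable

open scoped MatrixOrder in
-- Squaring is continuous and injective on the closed cone of positive semidefinite matrices, hence
-- a measurable embedding (Lusin–Souslin). The square root is its inverse there and `0` elsewhere.
lemma measurable_matrix_sqrt :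
    Measurable (CFC.sqrt : Matrix (Fin p) (Fin p) ℝ → Matrix (Fin p) (Fin p) ℝ) := by
  set s : Set (Matrix (Fin p) (Fin p) ℝ) := {A | A.PosSemidef} with hs
  have hinj : Set.InjOn (fun A : Matrix (Fin p) (Fin p) ℝ => A * A) s := fun A hA B hB hAB => by
    have hA : A.PosSemidef := hA
    have hB : B.PosSemidef := hB
    rw [← CFC.sqrt_mul_self A hA.nonneg, ← CFC.sqrt_mul_self B hB.nonneg]
    exact congrArg CFC.sqrt hAB
  have hemb := ContinuousOn.measurableEmbedding isClosed_posSemidef.measurableSet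
    (by fun_prop : ContinuousOn (fun A : Matrix (Fin p) (Fin p) ℝ => A * A) s) hinj
  have hext := hemb.measurable_extend (g := Subtype.val) (g' := fun _ => 0)
    measurable_subtype_coe measurable_const
  convert hext using 1
  ext1 A
  by_cases hA : A.PosSemidef
  · have hr : (CFC.sqrt A).PosSemidef := Matrix.nonneg_iff_posSemidef.1 (CFC.sqrt_nonneg A)
    have h1 : s.domRestrict (fun A : Matrix (Fin p) (Fin p) ℝ => A * A) ⟨CFC.sqrt A, hr⟩ = A :=
      CFC.sqrt_mul_sqrt_self A hA.nonneg
    conv_rhs => rw [← h1]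
    rw [hemb.injective.extend_apply]
  · rw [Function.extend_apply' _ _ _ ?_]
    · rw [CFC.sqrt, cfcₙ_apply_of_not_predicate]
      change ¬ (A - 0).PosSemidef
      simpa
    · rintro ⟨⟨B, hB⟩, rfl⟩
      refine hA ?_
      have := Matrix.posSemidef_conjTranspose_mul_self B
      rwa [(show B.PosSemidef from hB).isHermitian] at this

open scoped MatrixOrder in
-- The batch law is the image of one fixed standard Gaussian law under `√A`, so its value on `s` is
-- the measure of a section of a measurable set.
lemma measurable_batchLaw_apply {n : ℕ} {s : Set (Fin n → EuclideanSpace ℝ (Fin p))}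
    (hs : MeasurableSet s) : Measurable fun A : Matrix (Fin p) (Fin p) ℝ => batchLaw n A s := by
  set ν : Measure (Fin n → EuclideanSpace ℝ (Fin p)) :=
    Measure.pi fun _ => stdGaussian (EuclideanSpace ℝ (Fin p))
  set Φ : Matrix (Fin p) (Fin p) ℝ × (Fin n → EuclideanSpace ℝ (Fin p)) →
      (Fin n → EuclideanSpace ℝ (Fin p)) :=
    fun q j => 0 + Matrix.toEuclideanCLM (𝕜 := ℝ) (CFC.sqrt q.1) (q.2 j) with hΦ
  have hent : ∀ i k : Fin p, Measurable fun A : Matrix (Fin p) (Fin p) ℝ => CFC.sqrt A i k :=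
    fun i k => (measurable_entry i k).comp measurable_matrix_sqrt
  have hΦm : Measurable Φ := by
    refine measurable_pi_lambda _ fun j => ?_
    have : (fun q => Φ q j) = fun q => WithLp.toLp 2 fun i =>
        ∑ k, (CFC.sqrt q.1 : Matrix (Fin p) (Fin p) ℝ) i k * (q.2 j).ofLp k := by
      ext q i
      simp [hΦ, Matrix.ofLp_toEuclideanCLM, Matrix.mulVec, dotProduct]
    rw [this]
    have hc : ∀ i k : Fin p, Measurable fun q : Matrix (Fin p) (Fin p) ℝ ×
        (Fin n → EuclideanSpace ℝ (Fin p)) => (CFC.sqrt q.1 : Matrix (Fin p) (Fin p) ℝ) i k := fun i k =>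
      (hent i k).comp measurable_fst
    refine (PiLp.continuous_toLp 2 _).measurable.comp (measurable_pi_lambda _ fun i => ?_)
    refine Finset.measurable_sum _ fun k _ => (hc i k).mul ?_
    fun_prop
  have key : ∀ A : Matrix (Fin p) (Fin p) ℝ, batchLaw n A s = ν (Prod.mk A ⁻¹' (Φ ⁻¹' s)) := by
    intro A
    have hm : Measurable fun x : EuclideanSpace ℝ (Fin p) =>
      0 + Matrix.toEuclideanCLM (𝕜 := ℝ) (CFC.sqrt A) x := by fun_prop
    have hpr := Measure.isProbabilityMeasure_map
      (μ := stdGaussian (EuclideanSpace ℝ (Fin p))) hm.aemeasurable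
    have := Measure.pi_map_pi (μ := fun _ : Fin n => stdGaussian (EuclideanSpace ℝ (Fin p)))
      (f := fun (_ : Fin n) (x : EuclideanSpace ℝ (Fin p)) =>
        0 + Matrix.toEuclideanCLM (𝕜 := ℝ) (CFC.sqrt A) x) fun _ => hm.aemeasurable
    change Measure.pi (fun _ : Fin n => (stdGaussian (EuclideanSpace ℝ (Fin p))).map
      (fun x => 0 + Matrix.toEuclideanCLM (𝕜 := ℝ) (CFC.sqrt A) x)) s = _
    rw [← this, Measure.map_apply (by fun_prop) hs]
    rfl
  simp_rw [key]
  exact measurable_measure_prodMk_left (hΦm hs)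

/-- The law of a batch as a kernel from precision matrices. -/
noncomputable def batchKernel (n : ℕ) :
    Kernel (Matrix (Fin p) (Fin p) ℝ) (Fin n → EuclideanSpace ℝ (Fin p)) where
  toFun A := batchLaw n A
  measurable' := Measure.measurable_of_measurable_coe _ fun _ hs => measurable_batchLaw_apply hs

instance (n : ℕ) : IsMarkovKernel (batchKernel (p := p) n) :=
  ⟨fun A => inferInstanceAs (IsProbabilityMeasure (batchLaw n A))⟩

lemma measurable_matrix_inv :
    Measurable fun A : Matrix (Fin p) (Fin p) ℝ => A⁻¹ := by
  refine measurable_pi_lambda _ fun i => measurable_pi_lambda _ fun j => ?_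
  simp only [Matrix.inv_def, Matrix.smul_apply, Ring.inverse_eq_inv, smul_eq_mul]
  exact (continuous_id.matrix_det.measurable.inv).mul
    ((measurable_entry i j).comp (continuous_id.matrix_adjugate.measurable))

/-! ### Disintegration along the past -/

/-- A conditional law given on rectangles determines conditional expectations. -/
lemma setLIntegral_eq_of_conditional_law {Ω X W : Type*} [MeasurableSpace Ω] [MeasurableSpace X]
    [MeasurableSpace W] {P : Measure Ω} [IsFiniteMeasure P] {ξ : Ω → X} (hξ : Measurable ξ)
    {ζ : Ω → W} (hζ : Measurable ζ) (κ : Kernel X W) [IsMarkovKernel κ] {E : Set X}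
    (hE : MeasurableSet E)
    (h : ∀ A, MeasurableSet A → A ⊆ E → ∀ B, MeasurableSet B →
      P (ξ ⁻¹' A ∩ ζ ⁻¹' B) = ∫⁻ ω in ξ ⁻¹' A, κ (ξ ω) B ∂P)
    {F : X × W → ℝ≥0∞} (hF : Measurable F) :
    ∫⁻ ω in ξ ⁻¹' E, F (ξ ω, ζ ω) ∂P = ∫⁻ ω in ξ ⁻¹' E, ∫⁻ w, F (ξ ω, w) ∂κ (ξ ω) ∂P := by
  -- The hypothesis identifies the joint law on rectangles, which determine it.
  have key : (P.restrict (ξ ⁻¹' E)).map (fun ω => (ξ ω, ζ ω)) =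
      ((P.restrict (ξ ⁻¹' E)).map ξ) ⊗ₘ κ := by
    refine Measure.ext_prod fun {s t} hs ht => ?_
    rw [Measure.compProd_apply_prod hs ht, Measure.map_apply (hξ.prodMk hζ) (hs.prod ht),
      Measure.restrict_map hξ hs, lintegral_map (κ.measurable_coe ht) hξ,
      Measure.restrict_restrict (hξ hs), ← Set.preimage_inter,
      ← h (s ∩ E) (hs.inter hE) Set.inter_subset_right t ht,
      Measure.restrict_apply ((hξ.prodMk hζ) (hs.prod ht))]
    congr 1
    ext ω
    simp only [Set.mem_inter_iff, Set.mem_preimage, Set.mem_prod]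
    tauto
  have h1 : Measurable fun x => ∫⁻ w, F (x, w) ∂κ x := hF.lintegral_kernel_prod_right'
  rw [← lintegral_map (f := F) hF (hξ.prodMk hζ), key, Measure.lintegral_compProd hF,
    lintegral_map h1 hξ]

/-- Freezing the path at time `k` encodes the past in a sequence space that does not depend on `k`.
-/
lemma measurable_history_stopped {Ω : Type*} (θ : ℕ → Ω → Matrix (Fin p) (Fin p) ℝ) (k : ℕ) :
    Measurable[history θ k] fun ω (j : ℕ) => θ (min j k) ω := by
  refine @measurable_pi_lambda _ _ _ (history θ k) _ _ fun j =>
    @measurable_pi_lambda _ _ _ (history θ k) _ _ fun a =>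
    @measurable_pi_lambda _ _ _ (history θ k) _ _ fun b => ?_
  rw [measurable_iff_comap_le]
  refine le_trans ?_ (le_iSup₂ (f := fun j (_ : j ∈ Set.Iic k) =>
    ⨆ a, ⨆ b, MeasurableSpace.comap (fun ω => θ j ω a b) inferInstance) (min j k)
    (min_le_right j k))
  exact le_trans (le_iSup (fun b => MeasurableSpace.comap (fun ω => θ (min j k) ω a b)
    inferInstance) b) (le_iSup (fun a => ⨆ b, MeasurableSpace.comap
      (fun ω => θ (min j k) ω a b) inferInstance) a)

section Iterates

variable {Ω : Type*} [MeasurableSpace Ω] {P : Measure Ω}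
  {S : Matrix (Fin p) (Fin p) ℝ} {α lam γ : ℝ} {N : ℕ → ℕ} {θ₀ : Matrix (Fin p) (Fin p) ℝ}
  {θ : ℕ → Ω → Matrix (Fin p) (Fin p) ℝ}
  {z : (k : ℕ) → Ω → Fin (N k) → EuclideanSpace ℝ (Fin p)}

lemma IsStochasticProx.measurable_matrix (hθ : IsStochasticProx P S α lam γ N θ₀ θ z) (k : ℕ) :
    Measurable (θ k) :=
  measurable_pi_lambda _ fun a => measurable_pi_lambda _ fun b => hθ.measurable_state k a b

/-- The event that the first `k + 1` states have spectrum above `l`. -/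
def goodEvent (θ : ℕ → Ω → Matrix (Fin p) (Fin p) ℝ) (l : ℝ) (k : ℕ) : Set Ω :=
  {ω | ∀ j ≤ k, (θ j ω - l • (1 : Matrix (Fin p) (Fin p) ℝ)).PosSemidef}

lemma measurableSet_posSemidef_sub (l : ℝ) :
    MeasurableSet {A : Matrix (Fin p) (Fin p) ℝ |
      (A - l • (1 : Matrix (Fin p) (Fin p) ℝ)).PosSemidef} :=
  (isClosed_posSemidef.preimage (by fun_prop : Continuous fun A : Matrix (Fin p) (Fin p) ℝ =>
    A - l • (1 : Matrix (Fin p) (Fin p) ℝ))).measurableSet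

lemma IsStochasticProx.measurableSet_goodEvent (hθ : IsStochasticProx P S α lam γ N θ₀ θ z)
    (l : ℝ) (k : ℕ) : MeasurableSet (goodEvent θ l k) := by
  have : goodEvent θ l k = ⋂ j ∈ Set.Iic k, θ j ⁻¹' {A | (A - l • 1).PosSemidef} := by
    ext ω; simp [goodEvent]
  rw [this]
  exact MeasurableSet.biInter (Set.to_countable _) fun j _ =>
    hθ.measurable_matrix j (measurableSet_posSemidef_sub l)

/-- The good event involves the whole past, so conditioning is on the frozen path and not on `θ k`
alone; on this event `θ k` is positive definite, which `batch_law` requires. -/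
lemma IsStochasticProx.setLIntegral_goodEvent [IsFiniteMeasure P]
    (hθ : IsStochasticProx P S α lam γ N θ₀ θ z)
    {l : ℝ} (hl : 0 < l) (k : ℕ)
    {F : Matrix (Fin p) (Fin p) ℝ × (Fin (N (k + 1)) → EuclideanSpace ℝ (Fin p)) → ℝ≥0∞}
    (hF : Measurable F) :
    ∫⁻ ω in goodEvent θ l k, F (θ k ω, z (k + 1) ω) ∂P =
      ∫⁻ ω in goodEvent θ l k, ∫⁻ w, F (θ k ω, w) ∂batchLaw (N (k + 1)) (θ k ω)⁻¹ ∂P := by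
  set ξ : Ω → ℕ → Matrix (Fin p) (Fin p) ℝ := fun ω j => θ (min j k) ω with hξdef
  have hξ : Measurable ξ := measurable_pi_lambda _ fun j => hθ.measurable_matrix _
  have hξk : ∀ ω, ξ ω k = θ k ω := fun ω => by simp [hξdef]
  set E : Set (ℕ → Matrix (Fin p) (Fin p) ℝ) :=
    {x | ∀ j ≤ k, (x j - l • (1 : Matrix (Fin p) (Fin p) ℝ)).PosSemidef} with hEdef
  have hE : MeasurableSet E := by
    have : E = ⋂ j ∈ Set.Iic k, (fun x => x j) ⁻¹' {A | (A - l • 1).PosSemidef} := by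
      ext ω; simp [hEdef]
    rw [this]
    exact MeasurableSet.biInter (Set.to_countable _) fun j _ =>
      measurable_pi_apply j (measurableSet_posSemidef_sub l)
  have hEg : ξ ⁻¹' E = goodEvent θ l k := by
    ext ω
    refine forall₂_congr fun j hj => ?_
    simp only [hξdef, min_eq_left hj]
  have hinv : Measurable fun x : ℕ → Matrix (Fin p) (Fin p) ℝ => (x k)⁻¹ :=
    measurable_matrix_inv.comp (measurable_pi_apply k)
  have h := setLIntegral_eq_of_conditional_law hξ (hθ.measurable_batch (k + 1))
    ((batchKernel (N (k + 1))).comap _ hinv) hE (fun A hA hAE B hB => by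
      have h1 := hθ.batch_law k (ξ ⁻¹' A) (measurable_history_stopped θ k hA) (fun ω hω => by
        have := hAE hω k le_rfl
        rw [hξk] at this
        exact posDef_of_posSemidef_sub hl this) B hB
      rw [h1]
      refine lintegral_congr fun ω => ?_
      rw [Kernel.comap_apply, hξk]
      rfl)
    (F := fun q => F (q.1 k, q.2)) (hF.comp (by fun_prop))
  rw [hEg] at h
  simp only [hξk, Kernel.comap_apply] at h
  exact h

end Iterates

lemma exitTime_eq_top_iff {θ : ℕ → Matrix (Fin p) (Fin p) ℝ} {l : ℝ} {ψ : ℝ≥0∞} :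
    exitTime θ l ψ = ⊤ ↔ ∀ k, θ k ∈ spectralBox p l ψ := by
  simp only [exitTime, iInf_eq_top, Set.mem_ofPred_eq, ENat.natCast_ne_top, imp_false, not_not]

lemma measurable_frobNorm : Measurable fun A : Matrix (Fin p) (Fin p) ℝ => frobNorm A := by
  have : ∀ A : Matrix (Fin p) (Fin p) ℝ, frobNorm A = √(∑ i, ∑ j, A i j ^ 2) := fun A => by
    rw [← frobNorm_sq_eq_sum, Real.sqrt_sq (frobNorm_nonneg A)]
  simp_rw [this]
  have h := measurable_entry (p := p)
  fun_prop

lemma measurable_empCov_sub_inv (n : ℕ) :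
    Measurable fun q : Matrix (Fin p) (Fin p) ℝ × (Fin n → EuclideanSpace ℝ (Fin p)) =>
      empCov q.2 - q.1⁻¹ := by
  refine measurable_pi_lambda _ fun i => measurable_pi_lambda _ fun j => ?_
  exact ((measurable_empCov n i j).comp measurable_snd).sub
    ((measurable_entry i j).comp (measurable_matrix_inv.comp measurable_fst))

/-! ### Probability of the lower bound and the random norm bound -/

section Iterates

variable {Ω : Type*} [MeasurableSpace Ω] {P : Measure Ω}
  {S : Matrix (Fin p) (Fin p) ℝ} {α lam ε γ : ℝ} {N : ℕ → ℕ} {θ₀ : Matrix (Fin p) (Fin p) ℝ}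
  {θ : ℕ → Ω → Matrix (Fin p) (Fin p) ℝ}
  {z : (k : ℕ) → Ω → Fin (N k) → EuclideanSpace ℝ (Fin p)}

/-- The error of the gradient estimate used in step `k + 1`. -/
noncomputable def noise (θ : ℕ → Ω → Matrix (Fin p) (Fin p) ℝ)
    (z : (k : ℕ) → Ω → Fin (N k) → EuclideanSpace ℝ (Fin p)) (k : ℕ) (ω : Ω) :
    Matrix (Fin p) (Fin p) ℝ :=
  empCov (z (k + 1) ω) - (θ k ω)⁻¹

lemma IsStochasticProx.measurable_noise (hθ : IsStochasticProx P S α lam γ N θ₀ θ z) (k : ℕ) :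
    Measurable (noise θ z k) := by
  have h : Measurable fun ω => (θ k ω, z (k + 1) ω) :=
    (hθ.measurable_matrix k).prodMk (hθ.measurable_batch (k + 1))
  have h2 := (measurable_empCov_sub_inv (p := p) (N (k + 1))).comp h
  rw [Function.comp_def] at h2
  unfold noise
  exact h2

lemma goodEvent_antitone {Ω : Type*} {θ : ℕ → Ω → Matrix (Fin p) (Fin p) ℝ} {l : ℝ} {j k : ℕ} (h : j ≤ k) : goodEvent θ l k ⊆ goodEvent θ l j :=
  fun _ hω i hi => hω i (hi.trans h)

lemma IsStochasticProx.proxVI_step (hθ : IsStochasticProx P S α lam γ N θ₀ θ z) (hγ : 0 < γ)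
    (hα : 0 < α) (hα' : α ≤ 1) (hlam : 0 < lam) {l : ℝ} (hl : 0 < l) {k : ℕ} {ω : Ω}
    (hω : ω ∈ goodEvent θ l k) :
    ProxVI γ α lam (θ k ω - γ • (S - empCov (z (k + 1) ω))) (θ (k + 1) ω) :=
  (hθ.step k ω (posDef_of_posSemidef_sub hl (hω k le_rfl))).proxVI hγ hα hα' hlam

lemma IsStochasticProx.measure_goodEvent_inter_noise_gt_le [IsProbabilityMeasure P]
    (hθ : IsStochasticProx P S α lam γ N θ₀ θ z) {l : ℝ} (hl : 0 < l) (hε : 0 < ε)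
    {k : ℕ} (hN : 0 < N (k + 1)) :
    P (goodEvent θ l k ∩ {ω | ∃ i j, ε < |noise θ z k ω i j|}) ≤
      4 * (p : ℝ≥0∞) ^ 2 *
        ENNReal.ofReal (Real.exp (-(min 1 (ε ^ 2 * l ^ 2 / 16) * (N (k + 1) : ℝ)))) := by
  set c := 4 * (p : ℝ≥0∞) ^ 2 *
    ENNReal.ofReal (Real.exp (-(min 1 (ε ^ 2 * l ^ 2 / 16) * (N (k + 1) : ℝ)))) with hc
  have hBm : MeasurableSet {A : Matrix (Fin p) (Fin p) ℝ | ∃ i j, ε < |A i j|} := by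
    have : {A : Matrix (Fin p) (Fin p) ℝ | ∃ i j, ε < |A i j|} = ⋃ i, ⋃ j, {A | ε < |A i j|} := by
      ext A; simp
    rw [this]
    exact MeasurableSet.iUnion fun i => MeasurableSet.iUnion fun j =>
      measurableSet_lt measurable_const (continuous_abs.measurable.comp (measurable_entry i j))
  set F : Matrix (Fin p) (Fin p) ℝ × (Fin (N (k + 1)) → EuclideanSpace ℝ (Fin p)) → ℝ≥0∞ :=
    fun q => Set.indicator {A : Matrix (Fin p) (Fin p) ℝ | ∃ i j, ε < |A i j|} 1
      (empCov q.2 - q.1⁻¹) with hF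
  have hFm : Measurable F := (measurable_one.indicator hBm).comp (measurable_empCov_sub_inv _)
  have h := hθ.setLIntegral_goodEvent hl k hFm
  have e1 : ∀ ω, F (θ k ω, z (k + 1) ω) =
      Set.indicator {ω | ∃ i j, ε < |noise θ z k ω i j|} 1 ω := fun _ => rfl
  have hm : MeasurableSet {ω | ∃ i j, ε < |noise θ z k ω i j|} := hθ.measurable_noise k hBm
  simp_rw [e1] at h
  rw [lintegral_indicator_one hm, Measure.restrict_apply hm, Set.inter_comm] at h
  rw [h]
  calc _ ≤ ∫⁻ _ in goodEvent θ l k, c ∂P := by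
        refine setLIntegral_mono' (hθ.measurableSet_goodEvent l k) fun ω hω => ?_
        refine le_trans (le_of_eq ?_) (measure_exists_entry_gt_le hl hε (hω k le_rfl) hN)
        have hm' : MeasurableSet {w : Fin (N (k + 1)) → EuclideanSpace ℝ (Fin p) |
            ∃ i j, ε < |(empCov w - (θ k ω)⁻¹) i j|} :=
          ((measurable_empCov_sub_inv (N (k + 1))).comp measurable_prodMk_left) hBm
        rw [← lintegral_indicator_one hm']
        rfl
    _ ≤ c := by
        rw [setLIntegral_const]
        exact mul_le_of_le_one_right' prob_le_one

/-- With the stated probability the spectrum of every state stays above `ℓ⋆(ε)`. -/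
lemma IsStochasticProx.le_measure_forall_goodEvent [IsProbabilityMeasure P]
    (hθ : IsStochasticProx P S α lam γ N θ₀ θ z) (hp : 0 < p) (hα : 0 < α) (hα' : α ≤ 1)
    (hlam : 0 < lam) (hε : 0 < ε) (hγ : 0 < γ) (hγ' : γ ≤ ellStar S α lam ε ^ 2)
    (hN : ∀ k, 1 ≤ k → 0 < N k)
    (hθ₀ : (θ₀ - ellStar S α lam ε • (1 : Matrix (Fin p) (Fin p) ℝ)).PosSemidef) :
    1 - 4 * (p : ℝ≥0∞) ^ 2 * ∑' k : ℕ, ENNReal.ofReal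
        (Real.exp (-(min 1 (ε ^ 2 * ellStar S α lam ε ^ 2 / 16) * (N (k + 1) : ℝ)))) ≤
      P {ω | ∀ k, ω ∈ goodEvent θ (ellStar S α lam ε) k} := by
  have hl := ellStar_pos S hp hα hlam hε.le
  set l := ellStar S α lam ε with hldef
  set G := {ω | ∀ k, ω ∈ goodEvent θ l k}
  -- A path without large noise while still good stays good, by induction on `k`; hence each noise
  -- event only needs to be controlled on the good event before it.
  have hcompl : Gᶜ ⊆ ⋃ k, goodEvent θ l k ∩ {ω | ∃ i j, ε < |noise θ z k ω i j|} := by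
    intro ω hω
    by_contra hcon
    simp only [Set.mem_iUnion, not_exists, Set.mem_inter_iff, not_and, Set.mem_ofPred_eq,
      not_lt] at hcon
    refine hω fun k => ?_
    induction k with
    | zero =>
      intro j hj
      obtain rfl : j = 0 := by omega
      rw [hθ.init]; exact hθ₀
    | succ k ih =>
      intro j hj
      rcases Nat.lt_or_ge j (k + 1) with hlt | hge
      · exact ih j (by omega)
      · obtain rfl : j = k + 1 := by omega
        exact posSemidef_step hp hα hα' hlam hε.le hγ hγ' (posDef_of_posSemidef_sub hl (ih k le_rfl))
          (ih k le_rfl) (hcon k ih) (hθ.proxVI_step hγ hα hα' hlam hl ih)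
  rw [tsub_le_iff_right]
  calc (1 : ℝ≥0∞) = P (G ∪ Gᶜ) := by rw [Set.union_compl_self, measure_univ]
    _ ≤ P G + P Gᶜ := measure_union_le _ _
    _ ≤ P G + ∑' k, P (goodEvent θ l k ∩ {ω | ∃ i j, ε < |noise θ z k ω i j|}) := by
        gcongr
        exact (measure_mono hcompl).trans (measure_iUnion_le _)
    _ ≤ _ := by
        rw [← ENNReal.tsum_mul_left]
        gcongr with k
        exact hθ.measure_goodEvent_inter_noise_gt_le hl hε (hN (k + 1) (by omega))

/-- A random bound for the squared Frobenius norms of the states, integrable if the inverse batch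
sizes are summable. -/
lemma IsStochasticProx.exists_norm_bound [IsProbabilityMeasure P]
    (hθ : IsStochasticProx P S α lam γ N θ₀ θ z) (hS : S.PosSemidef) (hp : 0 < p) (hα : 0 < α)
    (hα' : α ≤ 1) (hlam : 0 < lam) (hε : 0 < ε) (hγ : 0 < γ) (hγ' : γ ≤ ellStar S α lam ε ^ 2)
    (hN : ∀ k, 1 ≤ k → 0 < N k) :
    ∃ V : Ω → ℝ≥0∞, Measurable V ∧
      (∀ k, ∀ ω ∈ goodEvent θ (ellStar S α lam ε) k,
        ENNReal.ofReal (frobNorm (θ k ω) ^ 2) ≤ V ω) ∧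
      ((Summable fun k : ℕ => 1 / (N (k + 1) : ℝ)) → ∫⁻ ω, V ω ∂P < ⊤) ∧
      ∀ ω, V ω < ⊤ → (∀ k, ω ∈ goodEvent θ (ellStar S α lam ε) k) →
        Tendsto (fun k => frobNorm (noise θ z k ω)) atTop (𝓝 0) := by
  have hSs : S.IsSymm := (posSemidef_iff_isSymm.1 hS).1
  have hl := ellStar_pos S hp hα hlam hε.le
  obtain ⟨u, hu⟩ := exists_isSolution hS hα hα' hlam
  obtain ⟨b, K, hb, hK, hub, hgrow⟩ := exists_step_growth hSs hp hα hα' hlam hε.le hγ hγ' hu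
  set l := ellStar S α lam ε with hldef
  set A := goodEvent θ l with hA
  have hAm : ∀ k, MeasurableSet (A k) := hθ.measurableSet_goodEvent l
  set w : Matrix (Fin p) (Fin p) ℝ → ℝ≥0∞ :=
    fun M => ENNReal.ofReal (max (frobNorm (M - u)) b ^ 2) with hw
  have hwm : Measurable w := by
    have h1 : Measurable fun M : Matrix (Fin p) (Fin p) ℝ => frobNorm (M - u) :=
      measurable_frobNorm.comp (measurable_pi_lambda _ fun i => measurable_pi_lambda _ fun j =>
        (measurable_entry i j).sub_const _)
    exact ((h1.max measurable_const).pow_const 2).ennreal_ofReal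
  set ξ : Matrix (Fin p) (Fin p) ℝ → ℝ≥0∞ := fun M => ENNReal.ofReal (K * frobNorm M ^ 2) with hξ
  have hξm : Measurable ξ := ((measurable_frobNorm.pow_const 2).const_mul K).ennreal_ofReal
  -- The allowed growth in step `k`, switched off once the lower bound has failed, where the law of
  -- the batch is no longer under control.
  set g : ℕ → Ω → ℝ≥0∞ :=
    fun k => (A k).indicator fun ω => w (θ k ω) * ξ (noise θ z k ω) with hg
  have hgm : ∀ k, Measurable (g k) := fun k =>
    ((hwm.comp (hθ.measurable_matrix k)).mul (hξm.comp (hθ.measurable_noise k))).indicator (hAm k)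
  have hstep : ∀ k, ∀ ω ∈ A k, w (θ (k + 1) ω) ≤ w (θ k ω) + g k ω := fun k ω hω => by
    have h1 := hgrow _ _ _ (posDef_of_posSemidef_sub hl (hω k le_rfl)) (hω k le_rfl)
      (hθ.proxVI_step hγ hα hα' hlam hl hω)
    have h2 : g k ω = w (θ k ω) * ξ (noise θ z k ω) := Set.indicator_of_mem hω _
    rw [h2]
    refine (ENNReal.ofReal_le_ofReal h1).trans_eq ?_
    rw [mul_add, mul_one, ENNReal.ofReal_add (sq_nonneg _)
      (mul_nonneg (sq_nonneg _) (mul_nonneg hK.le (sq_nonneg _))),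
      ENNReal.ofReal_mul (sq_nonneg _)]
    rfl
  have hsum : ∀ k, ∀ ω ∈ A k, w (θ k ω) ≤ w θ₀ + ∑ j ∈ Finset.range k, g j ω := by
    intro k
    induction k with
    | zero => intro ω _; rw [hθ.init]; simp
    | succ k ih =>
      intro ω hω
      have hωk := goodEvent_antitone (Nat.le_succ k) hω
      rw [Finset.sum_range_succ, ← add_assoc]
      exact (hstep k ω hωk).trans (by gcongr; exact ih ω hωk)
  have hwV : ∀ k, ∀ ω ∈ A k, w (θ k ω) ≤ w θ₀ + ∑' j, g j ω := fun k ω hω =>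
    (hsum k ω hω).trans (by gcongr; exact ENNReal.sum_le_tsum _)
  -- The factor `4` is the square of `2` in `‖θ‖ ≤ ‖u‖ + ‖θ - u‖ ≤ 2 max(‖θ - u‖, b)`.
  refine ⟨fun ω => 4 * (w θ₀ + ∑' j, g j ω), ?_, ?_, ?_, ?_⟩
  · exact ((Measurable.tsum hgm).const_add _).const_mul _
  · intro k ω hω
    refine le_trans ?_ (mul_le_mul_right (hwV k ω hω) 4)
    rw [hw]
    simp only
    rw [show (4 : ℝ≥0∞) = ENNReal.ofReal 4 by norm_num, ← ENNReal.ofReal_mul (by norm_num)]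
    refine ENNReal.ofReal_le_ofReal ?_
    have h1 := frobNorm_add_le u (θ k ω - u)
    rw [add_sub_cancel] at h1
    have h2 : frobNorm (θ k ω) ≤ 2 * max (frobNorm (θ k ω - u)) b := by
      linarith [le_max_left (frobNorm (θ k ω - u)) b, le_max_right (frobNorm (θ k ω - u)) b]
    have h3 := pow_le_pow_left₀ (frobNorm_nonneg _) h2 2
    linarith
  · intro hsumN
    obtain ⟨C, hC0, hC⟩ : ∃ C : ℝ, 0 ≤ C ∧ ∀ k, ∀ ω ∈ A k,
        ∫⁻ x, ξ (empCov x - (θ k ω)⁻¹) ∂batchLaw (N (k + 1)) (θ k ω)⁻¹ ≤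
          ENNReal.ofReal (C * (1 / (N (k + 1) : ℝ))) := by
      refine ⟨K * (p ^ 2 * (4 / l ^ 2 * Var[fun x : ℝ => x ^ 2 - 1; gaussianReal 0 1])),
        mul_nonneg hK.le (mul_nonneg (by positivity) (mul_nonneg (by positivity)
          (variance_nonneg _ _))), fun k ω hω => ?_⟩
      have h1 := lintegral_frobNorm_empCov_sub_sq_le hl (hω k le_rfl) (hN (k + 1) (by omega))
      simp only [hξ, ENNReal.ofReal_mul hK.le]
      rw [lintegral_const_mul' _ _ ENNReal.ofReal_ne_top, mul_assoc, ENNReal.ofReal_mul hK.le,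
        mul_one_div]
      exact mul_le_mul_right h1 _
    set c : ℕ → ℝ := fun k => C * (1 / (N (k + 1) : ℝ)) with hc
    have hc0 : ∀ k, 0 ≤ c k := fun k => by positivity
    have hcs : Summable c := hsumN.mul_left C
    have hgi : ∀ k, ∫⁻ ω, g k ω ∂P ≤ ENNReal.ofReal (c k) * ∫⁻ ω in A k, w (θ k ω) ∂P := by
      intro k
      rw [hg]
      simp only
      rw [lintegral_indicator (hAm k)]
      have h1 := hθ.setLIntegral_goodEvent hl k (F := fun q => w q.1 * ξ (empCov q.2 - q.1⁻¹))
        ((hwm.comp measurable_fst).mul (hξm.comp (measurable_empCov_sub_inv _)))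
      refine h1.trans_le ?_
      rw [← lintegral_const_mul' _ _ ENNReal.ofReal_ne_top]
      refine setLIntegral_mono' (hAm k) fun ω hω => ?_
      simp only
      rw [lintegral_const_mul' _ _ ENNReal.ofReal_ne_top, mul_comm]
      exact mul_le_mul_left (hC k ω hω) _
    -- Discrete Grönwall: `∏ (1 + c j) ≤ exp (∑ c j)`. The good events decrease, so passing from `A
    -- (k + 1)` to `A k` only enlarges the integral.
    have hI : ∀ k, ∫⁻ ω in A k, w (θ k ω) ∂P ≤
        w θ₀ * ENNReal.ofReal (Real.exp (∑ j ∈ Finset.range k, c j)) := by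
      intro k
      induction k with
      | zero =>
        simp only [hθ.init, Finset.range_zero, Finset.sum_empty, Real.exp_zero, ENNReal.ofReal_one,
          mul_one]
        rw [setLIntegral_const]
        exact mul_le_of_le_one_right' prob_le_one
      | succ k ih =>
        calc _ ≤ ∫⁻ ω in A k, w (θ (k + 1) ω) ∂P :=
              lintegral_mono_set (goodEvent_antitone (Nat.le_succ k))
          _ ≤ ∫⁻ ω in A k, (w (θ k ω) + g k ω) ∂P := setLIntegral_mono' (hAm k) (hstep k)
          _ = ∫⁻ ω in A k, w (θ k ω) ∂P + ∫⁻ ω in A k, g k ω ∂P :=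
              lintegral_add_right _ (hgm k)
          _ ≤ ∫⁻ ω in A k, w (θ k ω) ∂P + ENNReal.ofReal (c k) * ∫⁻ ω in A k, w (θ k ω) ∂P := by
              gcongr
              exact (setLIntegral_le_lintegral _ _).trans (hgi k)
          _ = (∫⁻ ω in A k, w (θ k ω) ∂P) * ENNReal.ofReal (1 + c k) := by
              rw [ENNReal.ofReal_add zero_le_one (hc0 k), ENNReal.ofReal_one]; ring
          _ ≤ w θ₀ * ENNReal.ofReal (Real.exp (∑ j ∈ Finset.range k, c j)) *
                ENNReal.ofReal (Real.exp (c k)) := by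
              gcongr
              linarith [Real.add_one_le_exp (c k)]
          _ = _ := by
              rw [mul_assoc, ← ENNReal.ofReal_mul (Real.exp_pos _).le, ← Real.exp_add,
                Finset.sum_range_succ]
    have hI' : ∀ k, ∫⁻ ω in A k, w (θ k ω) ∂P ≤
        w θ₀ * ENNReal.ofReal (Real.exp (∑' j, c j)) := fun k => (hI k).trans (by
      gcongr
      exact hcs.sum_le_tsum _ fun j _ => hc0 j)
    have hw0 : w θ₀ ≠ ⊤ := ENNReal.ofReal_ne_top
    rw [lintegral_const_mul' _ _ (by norm_num), lintegral_add_left measurable_const,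
      lintegral_tsum fun k => (hgm k).aemeasurable]
    have h2 : ∑' k, ∫⁻ ω, g k ω ∂P ≤ ENNReal.ofReal (∑' k, c k) *
        (w θ₀ * ENNReal.ofReal (Real.exp (∑' j, c j))) := by
      rw [ENNReal.ofReal_tsum_of_nonneg hc0 hcs, ← ENNReal.tsum_mul_right]
      exact ENNReal.tsum_le_tsum fun k => (hgi k).trans (mul_le_mul_right (hI' k) _)
    refine ENNReal.mul_lt_top (by norm_num) (ENNReal.add_lt_top.2 ⟨?_, h2.trans_lt ?_⟩)
    · simpa using hw0.lt_top
    · exact ENNReal.mul_lt_top ENNReal.ofReal_lt_top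
        (ENNReal.mul_lt_top hw0.lt_top ENNReal.ofReal_lt_top)
  · intro ω hV hω
    -- The truncation pays off again: `w ≥ b²`, so a finite sum of the `g j` forces the noise to
    -- tend to `0`.
    have h1 : ∑' j, g j ω ≠ ⊤ := by
      intro h
      simp [h] at hV
    have h2 := ENNReal.tendsto_atTop_zero_of_tsum_ne_top h1
    have h3 : ∀ k, ENNReal.ofReal (b ^ 2 * K * frobNorm (noise θ z k ω) ^ 2) ≤ g k ω := fun k => by
      have e : g k ω = w (θ k ω) * ξ (noise θ z k ω) := Set.indicator_of_mem (hω k) _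
      rw [e, mul_assoc, ENNReal.ofReal_mul (sq_nonneg _)]
      refine mul_le_mul_left (ENNReal.ofReal_le_ofReal ?_) _
      exact pow_le_pow_left₀ hb.le (le_max_right _ _) 2
    have h4 := tendsto_of_tendsto_of_tendsto_of_le_of_le tendsto_const_nhds h2
      (fun _ => zero_le) h3
    have h5 := (ENNReal.tendsto_toReal ENNReal.zero_ne_top).comp h4
    have h6 : Tendsto (fun k => b ^ 2 * K * frobNorm (noise θ z k ω) ^ 2) atTop (𝓝 0) := by
      refine h5.congr fun k => ?_
      exact ENNReal.toReal_ofReal (by positivity)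
    have h7 := (h6.const_mul (b ^ 2 * K)⁻¹).sqrt
    simp only [mul_zero, Real.sqrt_zero] at h7
    refine h7.congr fun k => ?_
    rw [inv_mul_cancel_left₀ (by positivity), Real.sqrt_sq (frobNorm_nonneg _)]

end Iterates

end ElasticNetPrecision

/-! ### Conclusion -/

theorem theorem2 {Ω : Type*} [MeasurableSpace Ω] (P : Measure Ω) [IsProbabilityMeasure P]
    (p : ℕ) (hp : 0 < p)
    (S : Matrix (Fin p) (Fin p) ℝ) (hS : S.PosSemidef)
    (α lam : ℝ) (hα : 0 < α) (hα' : α ≤ 1) (hlam : 0 < lam)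
    (ε : ℝ) (hε : 0 < ε)
    (γ : ℝ) (hγ : 0 < γ) (hγ' : γ ≤ ellStar S α lam ε ^ 2)
    (N : ℕ → ℕ) (hN : ∀ k, 1 ≤ k → 0 < N k)
    (θ₀ : Matrix (Fin p) (Fin p) ℝ)
    (hθ₀ : θ₀ ∈ spectralBox p (ellStar S α lam ε)
      (min (ENNReal.ofReal (psiUB S α lam)) (psiOne S α lam ε)))
    (θ : ℕ → Ω → Matrix (Fin p) (Fin p) ℝ)
    (z : (k : ℕ) → Ω → Fin (N k) → EuclideanSpace ℝ (Fin p))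
    (hθ : IsStochasticProx P S α lam γ N θ₀ θ z) :
    ∃ Ψ : Ω → ℝ≥0∞, Measurable Ψ ∧ (∀ ω, ENNReal.ofReal (ellStar S α lam ε) ≤ Ψ ω) ∧
      1 - 4 * (p : ℝ≥0∞) ^ 2 *
          ∑' k : ℕ, ENNReal.ofReal
            (Real.exp (-(min 1 (ε ^ 2 * ellStar S α lam ε ^ 2 / 16) * (N (k + 1) : ℝ))))
        ≤ P {ω | exitTime (fun k => θ k ω) (ellStar S α lam ε) (Ψ ω) = ⊤} ∧
      ((Summable fun k : ℕ => 1 / (N (k + 1) : ℝ)) →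
        (∫⁻ ω, Ψ ω ^ 2 ∂P) < ⊤ ∧ (∀ᵐ ω ∂P, Ψ ω < ⊤) ∧
        ∀ θhat : Matrix (Fin p) (Fin p) ℝ, IsSolution S α lam θhat →
          ∀ᵐ ω ∂P, exitTime (fun k => θ k ω) (ellStar S α lam ε) (Ψ ω) = ⊤ →
            Tendsto (fun k => θ k ω) atTop (𝓝 θhat)) := by
  have hSs : S.IsSymm := (posSemidef_iff_isSymm.1 hS).1
  have hl := ellStar_pos S hp hα hlam hε.le
  obtain ⟨V, hVm, hVb, hVi, hVn⟩ := hθ.exists_norm_bound hS hp hα hα' hlam hε hγ hγ' hN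
  have hmeas := hθ.le_measure_forall_goodEvent hp hα hα' hlam hε hγ hγ' hN
    ((le_eigMin_iff hp (isSymm_of_posDef hθ₀.1) _).1 hθ₀.2.1)
  set l := ellStar S α lam ε with hldef
  -- `V` bounds squared norms, hence the square root; the maximum enforces `Ψ ≥ ℓ⋆(ε)`.
  set Ψ : Ω → ℝ≥0∞ := fun ω => max (ENNReal.ofReal l) (V ω ^ (1 / 2 : ℝ)) with hΨ
  have hsqrt : ∀ x : ℝ≥0∞, (x ^ (1 / 2 : ℝ)) ^ 2 = x := fun x => by
    rw [← ENNReal.rpow_natCast, ← ENNReal.rpow_mul]; norm_num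
  have hΨ2 : ∀ ω, Ψ ω ^ 2 ≤ ENNReal.ofReal l ^ 2 + V ω := fun ω => by
    rcases max_choice (ENNReal.ofReal l) (V ω ^ (1 / 2 : ℝ)) with h | h
    · rw [hΨ]; simp only [h]; exact le_self_add
    · rw [hΨ]; simp only [h, hsqrt]; exact le_add_self
  -- On a path that keeps the lower bound, the upper one holds automatically by the choice of `Ψ`,
  -- so never leaving the box is the same as staying good forever.
  have hbox : ∀ ω, exitTime (fun k => θ k ω) l (Ψ ω) = ⊤ ↔ ∀ k, ω ∈ goodEvent θ l k := fun ω => by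
    rw [exitTime_eq_top_iff]
    constructor
    · exact fun h k j _ => (le_eigMin_iff hp (isSymm_of_posDef (h j).1) _).1 (h j).2.1
    · intro h k
      have hk := h k k le_rfl
      have hpd := posDef_of_posSemidef_sub hl hk
      refine ⟨hpd, (le_eigMin_iff hp (isSymm_of_posDef hpd) _).2 hk, le_max_of_le_right ?_⟩
      refine (ENNReal.ofReal_le_ofReal (eigMax_le_frobNorm hp (isSymm_of_posDef hpd))).trans ?_
      rw [← (ENNReal.pow_right_strictMono two_ne_zero).le_iff_le, hsqrt,
        ← ENNReal.ofReal_pow (frobNorm_nonneg _)]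
      exact hVb k ω (h k)
  refine ⟨Ψ, measurable_const.max (hVm.pow_const _), fun ω => le_max_left _ _, ?_, fun hN' => ?_⟩
  · simp only [hbox]
    exact hmeas
  · have hVlt : ∀ᵐ ω ∂P, V ω < ⊤ := ae_lt_top hVm (hVi hN').ne
    refine ⟨?_, ?_, fun θhat hhat => ?_⟩
    · refine (lintegral_mono hΨ2).trans_lt ?_
      rw [lintegral_add_left measurable_const, lintegral_const, measure_univ, mul_one]
      exact ENNReal.add_lt_top.2 ⟨ENNReal.pow_lt_top ENNReal.ofReal_lt_top, hVi hN'⟩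
    · filter_upwards [hVlt] with ω hω
      exact max_lt ENNReal.ofReal_lt_top (ENNReal.rpow_lt_top_of_nonneg (by norm_num) hω.ne)
    · filter_upwards [hVlt] with ω hω hexit
      have hgood := (hbox ω).1 hexit
      refine tendsto_of_noise_tendsto_zero hSs hp hα hα' hlam hε.le hγ hγ' hhat
        (C := fun k => empCov (z (k + 1) ω)) (B := √(V ω).toReal)
        (fun k => posDef_of_posSemidef_sub hl (hgood k k le_rfl)) (fun k => hgood k k le_rfl)
        (fun k => hθ.proxVI_step hγ hα hα' hlam hl (hgood k)) (fun k => ?_) (hVn ω hω hgood)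
      exact Real.le_sqrt_of_sq_le
        ((ENNReal.ofReal_le_iff_le_toReal hω.ne).1 (hVb k ω (hgood k)))
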